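/- Let $M$ be a transitive model of ZFC (a transitive set or class $M$ such that $(M,\in)$ satisfies ZFC). All structures, isomorphisms, automorphism groups and maps below are taken in $M$, i.e. they are elements of $M$; "formula" means formula of set theory, possibly with parameters from $M$. A *construction* in $M$ consists of formulas $\phi_1(x),\phi_2(x),\phi_3(x)$ such that: $\phi_1,\phi_2$ define in $M$ first-order languages $L$ and $L^-$ with $L^-\subseteq L$, where $L\setminus L^-$ contains a designated 1-ary relation symbol $P$; the class $\{a\in M: M\models\phi_3(a)\}$, called the *graph*, is a class of $L$-structures; for every $B$ in the graph, $P^B$ is the domain of an $L^-$-structure $B^-$ inside $B$ (the class of all these $B^-$ is the *domain* of the construction); the domain is closed under isomorphism of $L^-$-structures; and for all $A,B$ in the graph, every isomorphism from $A^-$ onto $B^-$ extends to an isomorphism from $A$ onto $B$. A construction is *rigid-based* if no $B^-$, for $B$ in its graph, has a nontrivial automorphism; *unitype* if its domain contains exactly one isomorphism type; *uniformisable* if there is a formula $\phi_4(x,y)$ such that for every $A$ in the domain there is a unique $B$ with $M\models\phi_4(A,B)$, and this $B$ is in the graph and $B^-=A$. For $B$ in the graph let $\nu_B:\mathrm{Aut}(B)\to\mathrm{Aut}(B^-)$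 be the restriction homomorphism. A *splitting* of a surjective group homomorphism $\nu:G\to H$ is a homomorphism $s:H\to G$ with $\nu s=\mathrm{id}_H$. A *weak splitting* of $\nu$ is a map $s:H\to G$ with $\nu s=\mathrm{id}_H$ for which there is a commutative subgroup $G_0$ of $G$ such that, whenever $f_1,\dots,f_k\in H$, $\varepsilon_i\in\{1,-1\}$ and $f_1^{\varepsilon_1}\cdots f_k^{\varepsilon_k}=1$, we have $s(f_1)^{\varepsilon_1}\cdots s(f_k)^{\varepsilon_k}\in G_0$. A construction is *natural* (respectively *weakly natural*) if for every $B$ in its graph $\nu_B$ has a splitting (respectively a weak splitting). **Theorem.** There is no transitive model $M$ of ZFC in which both of the following hold: (a) every rigid-based construction in $M$ is uniformisable; (b) every unitype uniformisable construction in $M$ is weakly natural. In particular, there is no transitive model of ZFC in which the natural constructions are exactly the uniformisable ones. -/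

import Mathlib

open FirstOrder

universe u

namespace NatDef

/-! ### The language of set theory and transitive models of ZFC -/

/-- The only symbol of the language of set theory: a binary relation symbol for membership. -/
inductive MemRel : ℕ → Type
  | mem : MemRel 2

/-- The first-order language of set theory. -/
def setLang : FirstOrder.Language.{0, 0} := ⟨fun _ => Empty, MemRel⟩

/-- Every class `M` of sets is read as the structure `(M, ∈)`. -/
instance (M : Set ZFSet.{u}) : setLang.Structure M where
  funMap f _ := nomatch f
  RelMap {_} r v := match r, v with
    | MemRel.mem, v => (v 0 : ZFSet.{u}) ∈ (v 1 : ZFSet.{u})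

/-- Formulas of set theory with parameters from `M`, with `n` free variables. -/
abbrev ParamFormula (M : Set ZFSet.{u}) (n : ℕ) : Type (u + 1) :=
  (setLang[[M]]).Formula (Fin n)

/-- `x` lies in `M` and `M ⊨ φ(x)`. -/
def Holds₁ {M : Set ZFSet.{u}} (φ : ParamFormula M 1) (x : ZFSet.{u}) : Prop :=
  ∃ hx : x ∈ M, φ.Realize ![(⟨x, hx⟩ : M)]

/-- `x` and `y` lie in `M` and `M ⊨ φ(x, y)`. -/
def Holds₂ {M : Set ZFSet.{u}} (φ : ParamFormula M 2) (x y : ZFSet.{u}) : Prop :=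
  ∃ (hx : x ∈ M) (hy : y ∈ M), φ.Realize ![(⟨x, hx⟩ : M), ⟨y, hy⟩]

/-- `M` is a transitive class (possibly a set) and `(M, ∈)` satisfies the axioms of ZFC.
Separation and replacement are schemata over first-order formulas with parameters from `M`. -/
structure IsTransitiveModelZFC (M : Set ZFSet.{u}) : Prop where
  transitive : ∀ x ∈ M, ∀ y ∈ x, y ∈ M
  extensionality : ∀ x ∈ M, ∀ y ∈ M, (∀ z ∈ M, z ∈ x ↔ z ∈ y) → x = y
  foundation : ∀ x ∈ M, (∃ y ∈ M, y ∈ x) → ∃ y ∈ M, y ∈ x ∧ ∀ z ∈ M, z ∈ y → z ∉ x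
  pairing : ∀ x ∈ M, ∀ y ∈ M, ∃ z ∈ M, ∀ w ∈ M, w ∈ z ↔ w = x ∨ w = y
  union : ∀ x ∈ M, ∃ y ∈ M, ∀ z ∈ M, z ∈ y ↔ ∃ w ∈ M, w ∈ x ∧ z ∈ w
  powerset : ∀ x ∈ M, ∃ y ∈ M, ∀ z ∈ M, z ∈ y ↔ ∀ w ∈ M, w ∈ z → w ∈ x
  infinity : ∃ x ∈ M, (∃ e ∈ M, e ∈ x ∧ ∀ z ∈ M, z ∉ e) ∧
    ∀ y ∈ M, y ∈ x → ∃ s ∈ M, s ∈ x ∧ ∀ z ∈ M, z ∈ s ↔ z ∈ y ∨ z = y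
  separation : ∀ φ : ParamFormula M 1, ∀ x ∈ M,
    ∃ y ∈ M, ∀ z ∈ M, z ∈ y ↔ z ∈ x ∧ Holds₁ φ z
  replacement : ∀ φ : ParamFormula M 2, ∀ x ∈ M,
    (∀ a ∈ M, a ∈ x → ∃! b, b ∈ M ∧ Holds₂ φ a b) →
    ∃ y ∈ M, ∀ b ∈ M, b ∈ y ↔ ∃ a ∈ M, a ∈ x ∧ Holds₂ φ a b
  choice : ∀ x ∈ M, (∀ y ∈ M, y ∈ x → ∃ z ∈ M, z ∈ y) →
    (∀ y ∈ M, ∀ y' ∈ M, y ∈ x → y' ∈ x → (∃ z ∈ M, z ∈ y ∧ z ∈ y') → y = y') →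
    ∃ c ∈ M, ∀ y ∈ M, y ∈ x → ∃! z, z ∈ M ∧ z ∈ y ∧ z ∈ c

/-! ### Relations and functions as sets of ordered pairs -/

/-- `g ∘ f`, for sets of ordered pairs. -/
def comp (g f : ZFSet.{u}) : ZFSet.{u} :=
  ZFSet.sep (fun p => ∃ x y z, p = ZFSet.pair x z ∧ ZFSet.pair x y ∈ f ∧ ZFSet.pair y z ∈ g)
    (ZFSet.prod (ZFSet.sUnion (ZFSet.sUnion f)) (ZFSet.sUnion (ZFSet.sUnion g)))

/-- The converse of a set of ordered pairs. -/
def inv (f : ZFSet.{u}) : ZFSet.{u} :=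
  ZFSet.sep (fun p => ∃ x y, p = ZFSet.pair y x ∧ ZFSet.pair x y ∈ f)
    (ZFSet.prod (ZFSet.sUnion (ZFSet.sUnion f)) (ZFSet.sUnion (ZFSet.sUnion f)))

/-- The identity on `D`. -/
def idOn (D : ZFSet.{u}) : ZFSet.{u} :=
  ZFSet.sep (fun p => ∃ x, p = ZFSet.pair x x) (ZFSet.prod D D)

/-- The restriction of `f` to arguments in `D`. -/
def restrict (f D : ZFSet.{u}) : ZFSet.{u} :=
  ZFSet.sep (fun p => ∃ x ∈ D, ∃ y, p = ZFSet.pair x y) f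

/-- `f` is a bijection from `D` onto `E`. -/
def IsBij (D E f : ZFSet.{u}) : Prop :=
  ZFSet.IsFunc D E f ∧ ∀ y ∈ E, ∃! x, ZFSet.pair x y ∈ f

/-! ### First-order languages and structures as sets -/

/-- The relation symbol of arity `n` named `a`. -/
def relSym (n a : ZFSet.{u}) : ZFSet.{u} := ZFSet.pair ∅ (ZFSet.pair n a)

/-- The function symbol of arity `n` named `a` (a constant if `n` is `0`). -/
def funSym (n a : ZFSet.{u}) : ZFSet.{u} := ZFSet.pair {∅} (ZFSet.pair n a)

/-- A first-order language is a set of relation and function symbols, with arities in `ω`. -/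
def IsLanguage (L : ZFSet.{u}) : Prop :=
  ∀ s ∈ L, ∃ n ∈ ZFSet.omega, ∃ a, s = relSym n a ∨ s = funSym n a

/-- The raw data of a set-coded structure: a domain and a set of pairs
`(symbol, interpretation)`. -/
@[ext]
structure Str where
  dom : ZFSet.{u}
  interp : ZFSet.{u}

/-- A structure as a set. -/
def Str.code (B : Str.{u}) : ZFSet.{u} := ZFSet.pair B.dom B.interp

/-- `v` is the interpretation of the symbol `s` in `B`. -/
def Str.Interprets (B : Str.{u}) (s v : ZFSet.{u}) : Prop := ZFSet.pair s v ∈ B.interp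

/-- `B` is an `L`-structure. An `n`-tuple from `B.dom` is a function from the von Neumann
number `n` to `B.dom`. -/
structure IsStr (L : ZFSet.{u}) (B : Str.{u}) : Prop where
  nonempty : B.dom.Nonempty
  interp_subset : ∀ p ∈ B.interp, ∃ s ∈ L, ∃ v, p = ZFSet.pair s v
  interp_unique : ∀ s ∈ L, ∃! v, B.Interprets s v
  rel : ∀ n a v, relSym n a ∈ L → B.Interprets (relSym n a) v → v ⊆ ZFSet.funs n B.dom
  func : ∀ n a v, funSym n a ∈ L → B.Interprets (funSym n a) v →
    ZFSet.IsFunc (ZFSet.funs n B.dom) B.dom v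

/-- `f` is an isomorphism of `L`-structures from `A` onto `B`. For an `n`-tuple `t`, the tuple
of the images of its entries is `comp f t`. -/
structure IsIso (L : ZFSet.{u}) (A B : Str.{u}) (f : ZFSet.{u}) : Prop where
  bij : IsBij A.dom B.dom f
  rel : ∀ n a v w, relSym n a ∈ L → A.Interprets (relSym n a) v → B.Interprets (relSym n a) w →
    ∀ t ∈ ZFSet.funs n A.dom, t ∈ v ↔ comp f t ∈ w
  func : ∀ n a v w, funSym n a ∈ L → A.Interprets (funSym n a) v → B.Interprets (funSym n a) w →
    ∀ t ∈ ZFSet.funs n A.dom, ∀ x y, ZFSet.pair t x ∈ v → ZFSet.pair x y ∈ f →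
      ZFSet.pair (comp f t) y ∈ w

/-- The set of elements of `B` that satisfy the 1-ary relation symbol `P`. -/
def Str.predSet (B : Str.{u}) (P : ZFSet.{u}) : ZFSet.{u} :=
  ZFSet.sep (fun b => ∃ v, B.Interprets P v ∧ {ZFSet.pair ∅ b} ∈ v) B.dom

/-- `A` is the `L'`-structure inside `B` whose domain is the set `P^B`; that is, `A = B⁻`. -/
structure IsMinus (L' P : ZFSet.{u}) (B A : Str.{u}) : Prop where
  isStr : IsStr L' A
  dom_eq : A.dom = B.predSet P
  rel : ∀ n a v w, relSym n a ∈ L' → A.Interprets (relSym n a) v → B.Interprets (relSym n a) w →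
    ∀ t ∈ ZFSet.funs n A.dom, t ∈ v ↔ t ∈ w
  func : ∀ n a v w, funSym n a ∈ L' → A.Interprets (funSym n a) v → B.Interprets (funSym n a) w →
    ∀ t ∈ ZFSet.funs n A.dom, ∀ x, ZFSet.pair t x ∈ v → ZFSet.pair t x ∈ w

/-! ### Constructions -/

/-- The three formulas of a construction, the two languages that the first two define, and the
designated 1-ary relation symbol `P`. -/
structure ConstructionData (M : Set ZFSet.{u}) where
  φ₁ : ParamFormula M 1
  φ₂ : ParamFormula M 1
  φ₃ : ParamFormula M 1
  L : ZFSet.{u}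
  L' : ZFSet.{u}
  P : ZFSet.{u}

namespace ConstructionData

variable {M : Set ZFSet.{u}}

/-- `B` is in the graph. -/
def InGraph (C : ConstructionData M) (B : Str.{u}) : Prop := Holds₁ C.φ₃ B.code

/-- `A = B⁻`. -/
def Minus (C : ConstructionData M) (B A : Str.{u}) : Prop := IsMinus C.L' C.P B A

/-- `A` is in the domain: `A = B⁻` for some `B` in the graph. -/
def InDomain (C : ConstructionData M) (A : Str.{u}) : Prop := ∃ B, C.InGraph B ∧ C.Minus B A

end ConstructionData

/-- Constructions in `M`. All isomorphisms are elements of `M`. -/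
structure Construction (M : Set ZFSet.{u}) extends ConstructionData M where
  L_mem : L ∈ M
  L'_mem : L' ∈ M
  L_isLanguage : IsLanguage L
  L'_isLanguage : IsLanguage L'
  φ₁_defines : ∀ s, Holds₁ φ₁ s ↔ s ∈ L
  φ₂_defines : ∀ s, Holds₁ φ₂ s ↔ s ∈ L'
  L'_subset : L' ⊆ L
  P_mem : P ∈ L
  P_notMem : P ∉ L'
  P_unary : ∃ a, P = relSym {∅} a
  graph_isStr : ∀ x, Holds₁ φ₃ x → ∃ B : Str.{u}, x = B.code ∧ IsStr L B
  exists_minus : ∀ B, toConstructionData.InGraph B →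
    ∃ A : Str.{u}, A.code ∈ M ∧ toConstructionData.Minus B A
  domain_closed : ∀ A A' : Str.{u}, toConstructionData.InDomain A → A'.code ∈ M → IsStr L' A' →
    (∃ f ∈ M, IsIso L' A A' f) → toConstructionData.InDomain A'
  extends_iso : ∀ A B A₀ B₀ : Str.{u}, toConstructionData.InGraph A →
    toConstructionData.InGraph B → toConstructionData.Minus A A₀ →
    toConstructionData.Minus B B₀ → ∀ f ∈ M, IsIso L' A₀ B₀ f →
    ∃ g ∈ M, IsIso L A B g ∧ f ⊆ g

/-! ### Automorphism groups in `M`, splittings and weak splittings -/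

/-- The automorphism group, in `M`, of an `L`-structure; the group operation is `comp`. -/
def autSet (M : Set ZFSet.{u}) (L : ZFSet.{u}) (A : Str.{u}) : ZFSet.{u} :=
  ZFSet.sep (fun f => f ∈ M ∧ IsIso L A A f) (ZFSet.powerset (ZFSet.prod A.dom A.dom))

/-- The product `f₁^ε₁ ⋯ f_k^ε_k` of permutations of `D`, where `true` stands for the exponent `1`
and `false` for `-1`. -/
def wordProd (D : ZFSet.{u}) : List (ZFSet.{u} × Bool) → ZFSet.{u}
  | [] => idOn D
  | (f, true) :: w => comp f (wordProd D w)
  | (f, false) :: w => comp (inv f) (wordProd D w)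

/-- The restriction of `s` to `H` is a map from `H` to `G`, and this map is an element of `M`. -/
def IsMapIn (M : Set ZFSet.{u}) (H G : ZFSet.{u}) (s : ZFSet.{u} → ZFSet.{u}) : Prop :=
  (∀ h ∈ H, s h ∈ G) ∧ ∃ c ∈ M, ∀ p, p ∈ c ↔ ∃ h ∈ H, p = ZFSet.pair h (s h)

/-- `G₀` is a commutative subgroup of the group `G` of permutations of `D`. -/
structure IsCommSubgroup (D G G₀ : ZFSet.{u}) : Prop where
  subset : G₀ ⊆ G
  one_mem : idOn D ∈ G₀
  mul_mem : ∀ f ∈ G₀, ∀ g ∈ G₀, comp f g ∈ G₀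
  inv_mem : ∀ f ∈ G₀, inv f ∈ G₀
  comm : ∀ f ∈ G₀, ∀ g ∈ G₀, comp f g = comp g f

namespace Construction

variable {M : Set ZFSet.{u}}

/-- Here `A = B⁻`. In `M`, the restriction map `Aut(B) → Aut(A)` splits. -/
def Splits (C : Construction M) (B A : Str.{u}) : Prop :=
  ∃ s : ZFSet.{u} → ZFSet.{u},
    IsMapIn M (autSet M C.L' A) (autSet M C.L B) s ∧
    (∀ h ∈ autSet M C.L' A, restrict (s h) A.dom = h) ∧
    ∀ h ∈ autSet M C.L' A, ∀ h' ∈ autSet M C.L' A, s (comp h h') = comp (s h) (s h')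

/-- Here `A = B⁻`. In `M`, the restriction map `Aut(B) → Aut(A)` weakly splits. -/
def WeaklySplits (C : Construction M) (B A : Str.{u}) : Prop :=
  ∃ s : ZFSet.{u} → ZFSet.{u},
    IsMapIn M (autSet M C.L' A) (autSet M C.L B) s ∧
    (∀ h ∈ autSet M C.L' A, restrict (s h) A.dom = h) ∧
    ∃ G₀ ∈ M, IsCommSubgroup B.dom (autSet M C.L B) G₀ ∧
      ∀ w : List (ZFSet.{u} × Bool), (∀ p ∈ w, p.1 ∈ autSet M C.L' A) →
        wordProd A.dom w = idOn A.dom →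
        wordProd B.dom (w.map fun p => (s p.1, p.2)) ∈ G₀

def Natural (C : Construction M) : Prop :=
  ∀ B A, C.InGraph B → C.Minus B A → C.Splits B A

def WeaklyNatural (C : Construction M) : Prop :=
  ∀ B A, C.InGraph B → C.Minus B A → C.WeaklySplits B A

/-- No `B⁻`, for `B` in the graph, has a nontrivial automorphism in `M`. -/
def RigidBased (C : Construction M) : Prop :=
  ∀ B A, C.InGraph B → C.Minus B A → ∀ f ∈ M, IsIso C.L' A A f → f = idOn A.dom

/-- The domain contains exactly one isomorphism type. -/
def Unitype (C : Construction M) : Prop :=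
  (∃ A, C.InDomain A) ∧
    ∀ A A', C.InDomain A → C.InDomain A' → ∃ f ∈ M, IsIso C.L' A A' f

/-- Some formula, with parameters from `M`, uniformises the graph. -/
def Uniformisable (C : Construction M) : Prop :=
  ∃ φ₄ : ParamFormula M 2, ∀ A, C.InDomain A →
    ∃ B : Str.{u}, Holds₂ φ₄ A.code B.code ∧ (∀ y, Holds₂ φ₄ A.code y → y = B.code) ∧
      C.InGraph B ∧ C.Minus B A

end Construction

end NatDef

/-!
Realise a surjection `ν : G → H` of finite groups by permutations of `n + m` and of `n` points, the
first extending the second. An `H`-torsor on a set is an orbit of `H` on the injective enumerations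
of an `n`-element subset. The structures of the graph are those that arise from a set with an
`H`-torsor by adding `m` points and a `G`-torsor of enumerations that lies over the given one. Such
an extension exists and is unique up to an isomorphism over the set, so isomorphisms lift.

Over the `n`-element sets the construction has a single type, and the restriction homomorphisms of
its structures are copies of `ν`. Over the well-founded extensional structures, it is rigid-based,
hence natural. A formula that uniformises it there also uniformises it over an `n`-element set `D`,
because `D` lies in its transitive closure, which is a well-founded extensional structure definable
from `D`. So if the theorem failed, every `ν` would have a weak splitting.

Take for `ν` the map from `Q₈ ≀ C₂` to `C₂ × Q₈ᵃᵇ` that multiplies the classes of the two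
coordinates of the base. Since `Q₈` has class two and `Q₈ᵃᵇ` is of exponent two, the commutator of
lifts of the swap and of the class of `x ∈ Q₈` has its first coordinate in `xZ(Q₈)`. The commutators
for two elements that do not commute therefore do not commute either, although both come from
relators of the commutative group `C₂ × Q₈ᵃᵇ`.
-/

namespace NatDef

/-! ### Definability in transitive models -/

section Definability

variable {M : Set ZFSet.{u}} {α β ι : Type*}

/-- `p` is definable over `(M, ∈)` with parameters from `M`. The variables are indexed by `α`. -/
def Definable (p : (α → M) → Prop) : Prop :=
  (∅ : Set M).Definable (setLang[[M]]) {v | p v}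

/-- `f` takes its values in `M`, and its graph is definable over `(M, ∈)` with parameters from `M`.
The variable `none` stands for the value. -/
structure DefinableFun (f : (α → M) → ZFSet.{u}) : Prop where
  mem : ∀ v, f v ∈ M
  graph : Definable fun w : Option α → M => (w none : ZFSet.{u}) = f fun i => w (some i)

theorem definable_iff_exists_formula {p : (α → M) → Prop} :
    Definable p ↔ ∃ φ : (setLang[[M]]).Formula α, ∀ v, φ.Realize v ↔ p v := by
  simp only [Definable, Set.empty_definable_iff, Set.ext_iff, Set.mem_ofPred_eq]
  exact exists_congr fun φ => forall_congr' fun v => Iff.comm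

namespace Definable

variable {p q : (α → M) → Prop}

theorem congr (hp : Definable p) (h : ∀ v, q v ↔ p v) : Definable q :=
  funext (fun v => propext (h v)) ▸ hp

theorem and (hp : Definable p) (hq : Definable q) : Definable fun v => p v ∧ q v :=
  Set.Definable.inter hp hq

theorem or (hp : Definable p) (hq : Definable q) : Definable fun v => p v ∨ q v :=
  Set.Definable.union hp hq

theorem not (hp : Definable p) : Definable fun v => ¬ p v :=
  Set.Definable.compl hp

theorem imp (hp : Definable p) (hq : Definable q) : Definable fun v => p v → q v :=
  (hp.not.or hq).congr fun _ => imp_iff_not_or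

theorem iff (hp : Definable p) (hq : Definable q) : Definable fun v => (p v ↔ q v) :=
  ((hp.imp hq).and (hq.imp hp)).congr fun _ => iff_iff_implies_and_implies

theorem reindex (hp : Definable p) (σ : α → β) : Definable fun w : β → M => p fun i => w (σ i) :=
  Set.Definable.preimage_comp σ hp

theorem specialize {p : (α → M) → (β → M) → Prop}
    (hp : Definable fun w : α ⊕ β → M => p (fun i => w (.inl i)) fun j => w (.inr j)) (a : α → M) :
    Definable (p a) := by
  obtain ⟨φ, hφ⟩ := definable_iff_exists_formula.1 hp
  let t : α ⊕ β → (setLang[[M]]).Term β := Sum.elim (fun i => (setLang.con (a i)).term) .var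
  refine definable_iff_exists_formula.2 ⟨φ.subst t, fun w => ?_⟩
  rw [Language.Formula.Realize, Language.BoundedFormula.realize_subst]
  have ht : (fun i => (t (.inl i)).realize w) = a :=
    funext fun i => Language.Term.realize_constants
  exact (hφ _).trans (iff_of_eq (congrArg (p · w) ht))

theorem exists_tuple [Finite β] {p : (α → M) → (β → ZFSet.{u}) → Prop}
    (hp : Definable fun w : α ⊕ β → M => p (fun i => w (.inl i)) fun j => w (.inr j)) :
    Definable fun v => ∃ x : β → ZFSet.{u}, (∀ j, x j ∈ M) ∧ p v x :=
  Definable.congr (Set.Definable.exists_of_finite hp) fun _ =>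
    ⟨fun ⟨x, hx, h⟩ => ⟨fun j => ⟨x j, hx j⟩, h⟩, fun ⟨x, h⟩ => ⟨fun j => x j, fun j => (x j).2, h⟩⟩

theorem ex {p : (α → M) → ZFSet.{u} → Prop}
    (hp : Definable fun w : Option α → M => p (fun i => w (some i)) (w none)) :
    Definable fun v => ∃ x ∈ M, p v x :=
  (exists_tuple (β := Unit) (p := fun v x => p v (x ())) <|
    hp.reindex fun o : Option α => o.elim (Sum.inr ()) Sum.inl).congr fun _ =>
      ⟨fun ⟨x, hx, h⟩ => ⟨fun _ => x, fun _ => hx, h⟩, fun ⟨_, hx, h⟩ => ⟨_, hx (), h⟩⟩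

theorem all {p : (α → M) → ZFSet.{u} → Prop}
    (hp : Definable fun w : Option α → M => p (fun i => w (some i)) (w none)) :
    Definable fun v => ∀ x ∈ M, p v x :=
  (ex (p := fun v x => ¬ p v x) hp.not).not.congr fun v => by push Not; rfl

theorem exists_index [Finite ι] {p : ι → (α → M) → Prop} (hp : ∀ i, Definable (p i)) :
    Definable fun v => ∃ i, p i v :=
  Definable.congr (Set.definable_iUnion_of_finite hp) fun _ => Set.mem_iUnion.symm

theorem forall_index [Finite ι] {p : ι → (α → M) → Prop} (hp : ∀ i, Definable (p i)) :
    Definable fun v => ∀ i, p i v :=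
  Definable.congr (Set.definable_iInter_of_finite hp) fun _ => Set.mem_iInter.symm

theorem const (q : Prop) : Definable fun _ : α → M => q := by
  by_cases h : q
  · exact Definable.congr Set.definable_univ fun _ => iff_of_true h trivial
  · exact Definable.congr Set.definable_empty fun _ => iff_of_false h id

theorem subst {p : (α → M) → ZFSet.{u} → Prop} {f : (α → M) → ZFSet.{u}}
    (hp : Definable fun w : Option α → M => p (fun i => w (some i)) (w none))
    (hf : DefinableFun f) : Definable fun v => p v (f v) :=
  (ex (p := fun v x => x = f v ∧ p v x) (hf.graph.and hp)).congr fun v =>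
    ⟨fun h => ⟨_, hf.mem v, rfl, h⟩, by rintro ⟨_, _, rfl, h⟩; exact h⟩

end Definable

namespace DefinableFun

variable {f g : (α → M) → ZFSet.{u}}

theorem var (i : α) : DefinableFun fun v : α → M => (v i : ZFSet.{u}) where
  mem v := (v i).2
  graph := definable_iff_exists_formula.2
    ⟨(Language.Term.var none).equal (Language.Term.var (some i)), fun _ =>
      Language.Formula.realize_equal.trans Subtype.ext_iff⟩

theorem const {c : ZFSet.{u}} (hc : c ∈ M) : DefinableFun fun _ : α → M => c where
  mem _ := hc
  graph := definable_iff_exists_formula.2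
    ⟨(Language.Term.var none).equal (setLang.con (⟨c, hc⟩ : M)).term, fun v => by
      rw [Language.Formula.realize_equal, Language.Term.realize_constants]
      exact Subtype.ext_iff⟩

theorem reindex (hf : DefinableFun f) (σ : α → β) :
    DefinableFun fun w : β → M => f fun i => w (σ i) where
  mem _ := hf.mem _
  graph := hf.graph.reindex (Option.map σ)

theorem specialize {f : (α → M) → ZFSet.{u} → ZFSet.{u}}
    (hf : DefinableFun fun w : Option α → M => f (fun i => w (some i)) (w none)) (v : α → M) :
    DefinableFun fun w : Fin 1 → M => f v (w 0) where
  mem w := hf.mem fun o => o.elim (w 0) v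
  graph := Definable.specialize
    (p := fun v (w : Option (Fin 1) → M) => (w none : ZFSet.{u}) = f v (w (some 0)))
    (hf.graph.reindex fun o =>
      o.elim (Sum.inr none) fun o => o.elim (Sum.inr (some 0)) Sum.inl) v

theorem definable_mem (hf : DefinableFun f) (hg : DefinableFun g) :
    Definable fun v => f v ∈ g v := by
  have h : Definable fun w : Fin 2 → M => (w 0 : ZFSet.{u}) ∈ (w 1 : ZFSet.{u}) :=
    definable_iff_exists_formula.2
      ⟨Language.Relations.formula₂ (Sum.inl MemRel.mem) (.var 0) (.var 1), fun v =>
        Language.Formula.realize_rel₂⟩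
  refine Definable.subst (p := fun v x => x ∈ g v) ?_ hf
  exact Definable.subst (p := fun w x => (w none : ZFSet.{u}) ∈ x)
    (h.reindex ![some none, none]) (hg.reindex some)

theorem definable_eq (hf : DefinableFun f) (hg : DefinableFun g) : Definable fun v => f v = g v :=
  Definable.subst (p := fun v x => x = g v) hg.graph hf

theorem definable_holds₂ (hf : DefinableFun f) (hg : DefinableFun g) (φ : ParamFormula M 2) :
    Definable fun v => Holds₂ φ (f v) (g v) := by
  have h : Definable fun w : Fin 2 → M => φ.Realize w :=
    definable_iff_exists_formula.2 ⟨φ, fun _ => Iff.rfl⟩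
  refine Definable.subst (p := fun v x => Holds₂ φ x (g v)) ?_ hf
  refine Definable.subst (p := fun w x => Holds₂ φ (w none) x) ?_ (hg.reindex some)
  refine (h.reindex ![some none, none]).congr fun w => ?_
  have hw : (fun i => w (![some none, none] i)) = ![w (some none), w none] :=
    funext fun i => by fin_cases i <;> rfl
  rw [hw]
  exact ⟨fun ⟨_, _, h⟩ => h, fun h => ⟨_, _, h⟩⟩

end DefinableFun

theorem Definable.exists_holds₁ {p : ZFSet.{u} → Prop}
    (hp : Definable fun v : Fin 1 → M => p (v 0)) :
    ∃ φ : ParamFormula M 1, ∀ x, Holds₁ φ x ↔ x ∈ M ∧ p x := by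
  obtain ⟨φ, hφ⟩ := definable_iff_exists_formula.1 hp
  exact ⟨φ, fun x => ⟨fun ⟨hx, h⟩ => ⟨hx, (hφ _).1 h⟩, fun ⟨hx, h⟩ => ⟨hx, (hφ _).2 h⟩⟩⟩

theorem Definable.exists_holds₂ {p : ZFSet.{u} → ZFSet.{u} → Prop}
    (hp : Definable fun v : Fin 2 → M => p (v 0) (v 1)) :
    ∃ φ : ParamFormula M 2, ∀ x y, Holds₂ φ x y ↔ x ∈ M ∧ y ∈ M ∧ p x y := by
  obtain ⟨φ, hφ⟩ := definable_iff_exists_formula.1 hp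
  exact ⟨φ, fun x y => ⟨fun ⟨hx, hy, h⟩ => ⟨hx, hy, (hφ _).1 h⟩,
    fun ⟨hx, hy, h⟩ => ⟨hx, hy, (hφ _).2 h⟩⟩⟩

end Definability

section Closure

/-- `M` is a transitive model of ZF without power set and infinity. The axioms are
stated as closure conditions, which are equivalent to them for transitive classes. -/
class IsTransitiveModelWeakZF (M : Set ZFSet.{u}) : Prop where
  nonempty : M.Nonempty
  mem_of_mem : ∀ x ∈ M, ∀ y ∈ x, y ∈ M
  upair_mem : ∀ x ∈ M, ∀ y ∈ M, {x, y} ∈ M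
  sUnion_mem : ∀ x ∈ M, ZFSet.sUnion x ∈ M
  sep_mem : ∀ φ : ParamFormula M 1, ∀ x ∈ M, ZFSet.sep (Holds₁ φ) x ∈ M
  image_mem : ∀ φ : ParamFormula M 2, ∀ x ∈ M, (∀ a ∈ x, ∃! b, Holds₂ φ a b) →
    ∃ y ∈ M, ∀ b, b ∈ y ↔ ∃ a ∈ x, Holds₂ φ a b

theorem IsTransitiveModelZFC.toWeakZF {M : Set ZFSet.{u}} (hM : IsTransitiveModelZFC M) :
    IsTransitiveModelWeakZF M := by
  have eq_of_mem_iff {x y : ZFSet.{u}} (hx : x ∈ M) (hy : ∀ z ∈ y, z ∈ M)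
      (h : ∀ z ∈ M, z ∈ x ↔ z ∈ y) : y ∈ M := by
    have hxy : x = y := ZFSet.ext fun z =>
      ⟨fun hz => (h z (hM.transitive x hx z hz)).1 hz, fun hz => (h z (hy z hz)).2 hz⟩
    exact hxy ▸ hx
  refine ⟨hM.infinity.imp fun _ h => h.1, hM.transitive, fun x hx y hy => ?_, fun x hx => ?_,
    fun φ x hx => ?_, fun φ x hx h => ?_⟩
  · obtain ⟨z, hz, h⟩ := hM.pairing x hx y hy
    refine eq_of_mem_iff hz (fun w hw => ?_) fun w hw => (h w hw).trans ZFSet.mem_pair.symm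
    obtain rfl | rfl := ZFSet.mem_pair.1 hw <;> assumption
  · obtain ⟨y, hy, h⟩ := hM.union x hx
    have mem_M {w : ZFSet.{u}} (hw : w ∈ x) : w ∈ M := hM.transitive x hx w hw
    refine eq_of_mem_iff hy (fun z hz => ?_) fun z hz => (h z hz).trans ?_
    · obtain ⟨w, hw, hzw⟩ := ZFSet.mem_sUnion.1 hz
      exact hM.transitive w (mem_M hw) z hzw
    · rw [ZFSet.mem_sUnion]
      exact ⟨fun ⟨w, _, hw⟩ => ⟨w, hw⟩, fun ⟨w, hw⟩ => ⟨w, mem_M hw.1, hw⟩⟩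
  · obtain ⟨y, hy, h⟩ := hM.separation φ x hx
    exact eq_of_mem_iff hy (fun z hz => hM.transitive x hx z (ZFSet.mem_sep.1 hz).1) fun z hz =>
      (h z hz).trans ZFSet.mem_sep.symm
  · have mem_M {a : ZFSet.{u}} (ha : a ∈ x) : a ∈ M := hM.transitive x hx a ha
    have holds_iff (a b : ZFSet.{u}) : b ∈ M ∧ Holds₂ φ a b ↔ Holds₂ φ a b :=
      and_iff_right_of_imp fun ⟨_, hb, _⟩ => hb
    obtain ⟨y, hy, hb⟩ := hM.replacement φ x hx fun a _ ha => by
      simpa only [holds_iff] using h a ha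
    refine ⟨y, hy, fun b => ⟨fun hby => ?_, fun ⟨a, ha, hab⟩ => ?_⟩⟩
    · obtain ⟨a, _, ha⟩ := (hb b (hM.transitive y hy b hby)).1 hby
      exact ⟨a, ha⟩
    · exact (hb b ((holds_iff a b).2 hab).1).2 ⟨a, mem_M ha, ha, hab⟩

variable {M : Set ZFSet.{u}} [hM : IsTransitiveModelWeakZF M] {α ι : Type*}

theorem mem_of_mem {x y : ZFSet.{u}} (hx : x ∈ M) (hy : y ∈ x) : y ∈ M :=
  hM.mem_of_mem x hx y hy

theorem sep_mem {p : ZFSet.{u} → Prop} (hp : Definable fun v : Fin 1 → M => p (v 0))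
    {x : ZFSet.{u}} (hx : x ∈ M) : ZFSet.sep p x ∈ M := by
  obtain ⟨φ, hφ⟩ := hp.exists_holds₁
  have h : ZFSet.sep p x = ZFSet.sep (Holds₁ φ) x := ZFSet.ext fun z => by
    rw [ZFSet.mem_sep, ZFSet.mem_sep, hφ]
    exact and_congr_right fun hz => (and_iff_right (mem_of_mem hx hz)).symm
  exact h ▸ hM.sep_mem φ x hx

theorem exists_image {p : ZFSet.{u} → ZFSet.{u} → Prop} {F : ZFSet.{u} → ZFSet.{u}}
    (hp : Definable fun v : Fin 2 → M => p (v 0) (v 1)) {x : ZFSet.{u}} (hx : x ∈ M)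
    (hF : ∀ a ∈ x, F a ∈ M) (hpF : ∀ a ∈ x, ∀ b ∈ M, p a b ↔ b = F a) :
    ∃ y ∈ M, ∀ b, b ∈ y ↔ ∃ a ∈ x, b = F a := by
  obtain ⟨φ, hφ⟩ := hp.exists_holds₂
  have holds_iff {a : ZFSet.{u}} (ha : a ∈ x) (b : ZFSet.{u}) : Holds₂ φ a b ↔ b = F a := by
    rw [hφ]
    refine ⟨fun h => (hpF a ha b h.2.1).1 h.2.2, ?_⟩
    rintro rfl
    exact ⟨mem_of_mem hx ha, hF a ha, (hpF a ha _ (hF a ha)).2 rfl⟩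
  obtain ⟨y, hy, hmem⟩ := hM.image_mem φ x hx fun a ha => by
    simp only [holds_iff ha, existsUnique_eq]
  exact ⟨y, hy, fun b => (hmem b).trans <| exists_congr fun a =>
    and_congr_right fun ha => holds_iff ha b⟩

theorem empty_mem : (∅ : ZFSet.{u}) ∈ M := by
  obtain ⟨x, hx⟩ := hM.nonempty
  have h := sep_mem (p := fun _ => False) (.const False) hx
  rwa [(ZFSet.eq_empty _).2 fun y hy => (ZFSet.mem_sep.1 hy).2] at h

namespace Definable

variable {p : (α → M) → ZFSet.{u} → Prop} {f : (α → M) → ZFSet.{u}}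

theorem exMem (hf : DefinableFun f)
    (hp : Definable fun w : Option α → M => p (fun i => w (some i)) (w none)) :
    Definable fun v => ∃ x ∈ f v, p v x :=
  (ex (p := fun v x => x ∈ f v ∧ p v x)
    (((DefinableFun.var none).definable_mem (hf.reindex some)).and hp)).congr fun v =>
      ⟨fun ⟨x, hx, h⟩ => ⟨x, mem_of_mem (hf.mem v) hx, hx, h⟩, fun ⟨x, _, h⟩ => ⟨x, h⟩⟩

theorem allMem (hf : DefinableFun f)
    (hp : Definable fun w : Option α → M => p (fun i => w (some i)) (w none)) :
    Definable fun v => ∀ x ∈ f v, p v x :=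
  (exMem (p := fun v x => ¬ p v x) hf hp.not).not.congr fun v => by push Not; rfl

end Definable

namespace DefinableFun

variable {f g : (α → M) → ZFSet.{u}}

theorem of_definable_mem (hf : ∀ v, f v ∈ M)
    (h : Definable fun w : Option α → M => (w none : ZFSet.{u}) ∈ f fun i => w (some i)) :
    DefinableFun f where
  mem := hf
  graph := by
    let p (w : Option α → M) (z : ZFSet.{u}) : Prop :=
      z ∈ (w none : ZFSet.{u}) ↔ z ∈ f fun i => w (some i)
    have hp : Definable fun w => ∀ z ∈ M, p w z := .all <|
      ((var none).definable_mem (var (some none))).iff (h.reindex (Option.map some))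
    refine hp.congr fun w => ⟨fun hw z _ => by simp only [p, hw], fun hw => ZFSet.ext fun z => ?_⟩
    exact ⟨fun hz => (hw z (mem_of_mem (w none).2 hz)).1 hz,
      fun hz => (hw z (mem_of_mem (hf _) hz)).2 hz⟩

theorem sep {p : (α → M) → ZFSet.{u} → Prop}
    (hp : Definable fun w : Option α → M => p (fun i => w (some i)) (w none))
    (hf : DefinableFun f) : DefinableFun fun v => ZFSet.sep (p v) (f v) := by
  refine of_definable_mem (fun v => sep_mem ?_ (hf.mem v)) ?_
  · exact Definable.specialize (p := fun v (w : Fin 1 → M) => p v (w 0))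
      (hp.reindex fun o => o.elim (Sum.inr 0) Sum.inl) v
  · simp only [ZFSet.mem_sep]
    exact ((var none).definable_mem (hf.reindex some)).and hp

theorem upair (hf : DefinableFun f) (hg : DefinableFun g) :
    DefinableFun fun v => ({f v, g v} : ZFSet.{u}) :=
  of_definable_mem (fun v => hM.upair_mem _ (hf.mem v) _ (hg.mem v)) <| by
    simp only [ZFSet.mem_pair]
    exact ((var none).definable_eq (hf.reindex some)).or
      ((var none).definable_eq (hg.reindex some))

theorem singleton (hf : DefinableFun f) : DefinableFun fun v => ({f v} : ZFSet.{u}) := by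
  simpa only [ZFSet.pair_eq_singleton] using hf.upair hf

theorem pair (hf : DefinableFun f) (hg : DefinableFun g) :
    DefinableFun fun v => ZFSet.pair (f v) (g v) :=
  hf.singleton.upair (hf.upair hg)

theorem sUnion (hf : DefinableFun f) : DefinableFun fun v => ZFSet.sUnion (f v) :=
  of_definable_mem (fun v => hM.sUnion_mem _ (hf.mem v)) <| by
    simp only [ZFSet.mem_sUnion]
    exact Definable.exMem (hf.reindex some) ((var (some none)).definable_mem (var none))

theorem biUnion {F : (α → M) → ZFSet.{u} → ZFSet.{u}} (hg : DefinableFun g)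
    (hF : DefinableFun fun w : Option α → M => F (fun i => w (some i)) (w none))
    (h : ∀ v x, x ∈ f v ↔ ∃ d ∈ g v, x ∈ F v d) : DefinableFun f := by
  refine of_definable_mem (fun v => ?_) ?_
  · have hFv := hF.specialize v
    have h_graph : Definable fun w : Fin 2 → M => (w 1 : ZFSet.{u}) = F v (w 0) :=
      (var 1).definable_eq (hFv.reindex fun _ => 0)
    obtain ⟨y, hy, hmem⟩ := exists_image (p := fun a b => b = F v a) h_graph (hg.mem v)
      (fun a ha => hFv.mem fun _ => ⟨a, mem_of_mem (hg.mem v) ha⟩) fun _ _ _ _ => Iff.rfl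
    have hf : f v = ZFSet.sUnion y := ZFSet.ext fun x => by
      simp only [h, ZFSet.mem_sUnion, hmem]
      exact ⟨fun ⟨d, hd, hx⟩ => ⟨_, ⟨d, hd, rfl⟩, hx⟩,
        fun ⟨_, ⟨d, hd, hd'⟩, hx⟩ => ⟨d, hd, hd' ▸ hx⟩⟩
    exact hf ▸ hM.sUnion_mem y hy
  · simp only [h]
    exact Definable.exMem (hg.reindex some)
      ((var (some none)).definable_mem (hF.reindex (Option.map some)))

theorem image {F : (α → M) → ZFSet.{u} → ZFSet.{u}} (hg : DefinableFun g)
    (hF : DefinableFun fun w : Option α → M => F (fun i => w (some i)) (w none))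
    (h : ∀ v x, x ∈ f v ↔ ∃ d ∈ g v, x = F v d) : DefinableFun f :=
  biUnion (F := fun v d => {F v d}) hg hF.singleton fun v x => by
    simp only [h, ZFSet.mem_singleton]

theorem union (hf : DefinableFun f) (hg : DefinableFun g) : DefinableFun fun v => f v ∪ g v :=
  (hf.upair hg).sUnion

theorem sdiff (hf : DefinableFun f) (hg : DefinableFun g) : DefinableFun fun v => f v \ g v := by
  have h (v : α → M) : f v \ g v = ZFSet.sep (fun x => x ∉ g v) (f v) := ZFSet.ext fun x => by
    rw [ZFSet.mem_sdiff, ZFSet.mem_sep]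
  simp only [h]
  exact hf.sep ((var none).definable_mem (hg.reindex some)).not

theorem insert (hf : DefinableFun f) (hg : DefinableFun g) :
    DefinableFun fun v => (Insert.insert (f v) (g v) : ZFSet.{u}) := by
  simpa only [ZFSet.insert_eq] using hf.singleton.union hg

end DefinableFun

theorem pair_mem {x y : ZFSet.{u}} (hx : x ∈ M) (hy : y ∈ M) : ZFSet.pair x y ∈ M :=
  ((DefinableFun.const hx).pair (.const hy)).mem Empty.elim

theorem of_pair_mem {x y : ZFSet.{u}} (h : ZFSet.pair x y ∈ M) : x ∈ M ∧ y ∈ M := by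
  have hxy : {x, y} ∈ M := mem_of_mem h (by simp [ZFSet.pair])
  exact ⟨mem_of_mem hxy (by simp), mem_of_mem hxy (by simp)⟩

theorem exists_mem_coe_eq {s : Set ZFSet.{u}} (hs : s.Finite) (hsM : s ⊆ M) :
    ∃ x ∈ M, (x : Set ZFSet.{u}) = s := by
  induction s, hs using Set.Finite.induction_on with
  | empty => exact ⟨∅, empty_mem, by simp⟩
  | @insert a s _ _ ih =>
    rw [Set.insert_subset_iff] at hsM
    obtain ⟨x, hx, rfl⟩ := ih hsM.2
    exact ⟨Insert.insert a x,
      ((DefinableFun.const hsM.1).insert (.const hx)).mem Empty.elim, by simp⟩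

theorem range_mem [Finite ι] [Small.{u} ι] {t : ι → ZFSet.{u}} (ht : ∀ i, t i ∈ M) :
    ZFSet.range t ∈ M := by
  obtain ⟨x, hx, hxt⟩ := exists_mem_coe_eq (Set.finite_range t) (Set.range_subset_iff.2 ht)
  rwa [← SetLike.coe_injective (hxt.trans (ZFSet.coe_range t).symm)]

namespace DefinableFun

variable {f g : (α → M) → ZFSet.{u}}

theorem range [Finite ι] [Small.{u} ι] {t : ι → (α → M) → ZFSet.{u}}
    (ht : ∀ i, DefinableFun (t i)) : DefinableFun fun v => ZFSet.range fun i => t i v := by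
  refine of_definable_mem (fun v => range_mem fun i => (ht i).mem v) ?_
  simp only [ZFSet.mem_range]
  exact .exists_index fun i => ((ht i).reindex some).definable_eq (var none)

theorem definable_subset (hf : DefinableFun f) (hg : DefinableFun g) :
    Definable fun v => f v ⊆ g v :=
  (Definable.allMem (p := fun v x => x ∈ g v) hf
    ((var none).definable_mem (hg.reindex some))).congr fun _ => Iff.rfl

theorem definable_isTransitive (hf : DefinableFun f) : Definable fun v => (f v).IsTransitive :=
  (Definable.allMem (p := fun v x => x ⊆ f v) hf
    ((var none).definable_subset (hf.reindex some))).congr fun _ => Iff.rfl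

end DefinableFun

end Closure

section TransitiveClosure

/-- The transitive closure of a set. -/
noncomputable def tc (x : ZFSet.{u}) : ZFSet.{u} :=
  ZFSet.sep (Relation.TransGen (· ∈ ·) · x) (ZFSet.vonNeumann x.rank)

theorem mem_tc {x z : ZFSet.{u}} : z ∈ tc x ↔ Relation.TransGen (· ∈ ·) z x := by
  rw [tc, ZFSet.mem_sep, ZFSet.mem_vonNeumann, and_iff_right_iff_imp]
  intro h
  induction h with
  | single h => exact ZFSet.rank_lt_of_mem h
  | tail _ h ih => exact ih.trans (ZFSet.rank_lt_of_mem h)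

theorem isTransitive_tc (x : ZFSet.{u}) : (tc x).IsTransitive := fun _ hy _ hz =>
  mem_tc.2 (.head hz (mem_tc.1 hy))

theorem subset_tc (x : ZFSet.{u}) : x ⊆ tc x := fun _ hy => mem_tc.2 (.single hy)

theorem tc_subset {x T : ZFSet.{u}} (hT : T.IsTransitive) (hx : x ⊆ T) : tc x ⊆ T := fun z hz => by
  induction mem_tc.1 hz using Relation.TransGen.head_induction_on with
  | single h => exact hx h
  | head h h' ih => exact hT _ (ih (mem_tc.2 h')) h

theorem tc_eq_union (x : ZFSet.{u}) : tc x = x ∪ ZFSet.sUnion (ZFSet.range fun y : x => tc y) := by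
  ext z
  simp only [ZFSet.mem_union, ZFSet.mem_sUnion, ZFSet.mem_range, mem_tc]
  constructor
  · rintro (h | ⟨h, hy⟩)
    · exact .inl h
    · exact .inr ⟨_, ⟨⟨_, hy⟩, rfl⟩, mem_tc.2 h⟩
  · rintro (h | ⟨_, ⟨y, rfl⟩, h⟩)
    · exact .single h
    · exact .tail (mem_tc.1 h) y.2

variable {M : Set ZFSet.{u}}

theorem eq_tc_iff {x T : ZFSet.{u}} (hx : tc x ∈ M) : T = tc x ↔
    T.IsTransitive ∧ x ⊆ T ∧ ∀ S ∈ M, S.IsTransitive → x ⊆ S → T ⊆ S := by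
  constructor
  · rintro rfl
    exact ⟨isTransitive_tc x, subset_tc x, fun S _ => tc_subset⟩
  · rintro ⟨hT, hxT, h⟩
    exact (h _ hx (isTransitive_tc x) (subset_tc x)).antisymm (tc_subset hT hxT)

variable [hM : IsTransitiveModelWeakZF M] {α : Type*}

theorem definable_isLeastTransitive {f g : (α → M) → ZFSet.{u}} (hf : DefinableFun f)
    (hg : DefinableFun g) : Definable fun v => (g v).IsTransitive ∧ f v ⊆ g v ∧
      ∀ S ∈ M, S.IsTransitive → f v ⊆ S → g v ⊆ S :=
  hg.definable_isTransitive.and <| (hf.definable_subset hg).and <|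
    Definable.all (p := fun v S => S.IsTransitive → f v ⊆ S → g v ⊆ S) <|
      (DefinableFun.var none).definable_isTransitive.imp <|
        ((hf.reindex some).definable_subset (.var none)).imp <|
          (hg.reindex some).definable_subset (.var none)

theorem tc_mem {x : ZFSet.{u}} (hx : x ∈ M) : tc x ∈ M := by
  induction x using ZFSet.inductionOn with
  | h x ih =>
  have ih' (y : ZFSet.{u}) (hy : y ∈ x) : tc y ∈ M := ih y hy (mem_of_mem hx hy)
  obtain ⟨Y, hY, hmem⟩ := exists_image (definable_isLeastTransitive (.var 0) (.var 1)) hx ih'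
    fun a ha b _ => (eq_tc_iff (ih' a ha)).symm
  have h : ZFSet.range (fun y : x => tc y) = Y := ZFSet.ext fun T => by
    simp [hmem, eq_comm]
  rw [tc_eq_union, h]
  exact ((DefinableFun.const hx).union (DefinableFun.const hY).sUnion).mem Empty.elim

theorem DefinableFun.tc {f : (α → M) → ZFSet.{u}} (hf : DefinableFun f) :
    DefinableFun fun v => tc (f v) where
  mem v := tc_mem (hf.mem v)
  graph := (definable_isLeastTransitive (hf.reindex some) (.var none)).congr fun _ =>
    eq_tc_iff (tc_mem (hf.mem _))

end TransitiveClosure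

/-! ### Graphs of functions and tuples -/

section Graph

variable {D E E' f : ZFSet.{u}} {F F' : ZFSet.{u} → ZFSet.{u}}

/-- The restriction of `F` to `D`, as a set of ordered pairs. -/
noncomputable def graphOn (F : ZFSet.{u} → ZFSet.{u}) (D : ZFSet.{u}) : ZFSet.{u} :=
  ZFSet.range fun x : D => ZFSet.pair x (F x)

theorem mem_graphOn {p : ZFSet.{u}} : p ∈ graphOn F D ↔ ∃ x ∈ D, p = ZFSet.pair x (F x) := by
  simp only [graphOn, ZFSet.mem_range, Subtype.exists, exists_prop, eq_comm]

theorem pair_mem_graphOn {x y : ZFSet.{u}} : ZFSet.pair x y ∈ graphOn F D ↔ x ∈ D ∧ y = F x := by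
  simp only [mem_graphOn, ZFSet.pair_inj]
  exact ⟨by rintro ⟨x, hx, rfl, h⟩; exact ⟨hx, h⟩, fun ⟨hx, h⟩ => ⟨x, hx, rfl, h⟩⟩

theorem graphOn_inj : graphOn F D = graphOn F' D ↔ Set.EqOn F F' D := by
  refine ⟨fun h x hx => ?_, fun h => ZFSet.ext fun p => ?_⟩
  · have hp : ZFSet.pair x (F x) ∈ graphOn F' D := h ▸ pair_mem_graphOn.2 ⟨hx, rfl⟩
    exact (pair_mem_graphOn.1 hp).2
  · rw [mem_graphOn, mem_graphOn]
    exact exists_congr fun x => and_congr_right fun hx => by rw [h hx]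

theorem graphOn_union : graphOn F (D ∪ E) = graphOn F D ∪ graphOn F E := by
  ext p
  simp only [ZFSet.mem_union, mem_graphOn, or_and_right, exists_or]

theorem graphOn_range {ι : Type*} [Small.{u} ι] (t : ι → ZFSet.{u}) :
    graphOn F (ZFSet.range t) = ZFSet.range fun i => ZFSet.pair (t i) (F (t i)) := by
  ext p
  simp only [mem_graphOn, ZFSet.mem_range, exists_exists_eq_and]
  exact exists_congr fun _ => eq_comm

theorem graphOn_subset_prod (h : Set.MapsTo F D E) : graphOn F D ⊆ ZFSet.prod D E := fun p hp => by
  obtain ⟨x, hx, rfl⟩ := mem_graphOn.1 hp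
  exact ZFSet.pair_mem_prod.2 ⟨hx, h hx⟩

theorem pair_mem_comp {x z g : ZFSet.{u}} :
    ZFSet.pair x z ∈ comp g f ↔ ∃ y, ZFSet.pair x y ∈ f ∧ ZFSet.pair y z ∈ g := by
  rw [comp, ZFSet.mem_sep]
  constructor
  · rintro ⟨-, x, y, z, h, hf, hg⟩
    obtain ⟨rfl, rfl⟩ := ZFSet.pair_inj.1 h
    exact ⟨y, hf, hg⟩
  · rintro ⟨y, hf, hg⟩
    refine ⟨ZFSet.pair_mem_prod.2 ⟨ZFSet.mem_sUnion.2 ⟨{x, y}, ZFSet.mem_sUnion.2 ⟨_, hf, ?_⟩, ?_⟩,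
      ZFSet.mem_sUnion.2 ⟨{y, z}, ZFSet.mem_sUnion.2 ⟨_, hg, ?_⟩, ?_⟩⟩, x, y, z, rfl, hf, hg⟩ <;>
    simp [ZFSet.pair]

theorem pair_mem_inv {x y : ZFSet.{u}} : ZFSet.pair y x ∈ inv f ↔ ZFSet.pair x y ∈ f := by
  rw [inv, ZFSet.mem_sep]
  constructor
  · rintro ⟨-, x, y, h, hf⟩
    obtain ⟨rfl, rfl⟩ := ZFSet.pair_inj.1 h
    exact hf
  · intro hf
    refine ⟨ZFSet.pair_mem_prod.2 ⟨ZFSet.mem_sUnion.2 ⟨{x, y}, ZFSet.mem_sUnion.2 ⟨_, hf, ?_⟩, ?_⟩,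
      ZFSet.mem_sUnion.2 ⟨{x, y}, ZFSet.mem_sUnion.2 ⟨_, hf, ?_⟩, ?_⟩⟩, x, y, rfl, hf⟩ <;>
    simp [ZFSet.pair]

theorem exists_of_mem_comp {g p : ZFSet.{u}} (h : p ∈ comp g f) : ∃ x z, p = ZFSet.pair x z := by
  obtain ⟨-, x, -, z, rfl, -⟩ := ZFSet.mem_sep.1 h
  exact ⟨x, z, rfl⟩

theorem comp_graphOn (h : Set.MapsTo F D E) :
    comp (graphOn F' E) (graphOn F D) = graphOn (F' ∘ F) D := by
  ext p
  constructor
  · intro hp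
    obtain ⟨x, z, rfl⟩ := exists_of_mem_comp hp
    obtain ⟨y, hy, hz⟩ := pair_mem_comp.1 hp
    obtain ⟨hx, rfl⟩ := pair_mem_graphOn.1 hy
    exact pair_mem_graphOn.2 ⟨hx, (pair_mem_graphOn.1 hz).2⟩
  · intro hp
    obtain ⟨x, hx, rfl⟩ := mem_graphOn.1 hp
    exact pair_mem_comp.2 ⟨F x, pair_mem_graphOn.2 ⟨hx, rfl⟩, pair_mem_graphOn.2 ⟨h hx, rfl⟩⟩

theorem inv_graphOn (h : Set.MapsTo F D E) (h' : Set.MapsTo F' E D)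
    (hFF' : Set.InvOn F' F D E) : inv (graphOn F D) = graphOn F' E := by
  ext p
  constructor
  · intro hp
    obtain ⟨-, x, y, rfl, hf⟩ := ZFSet.mem_sep.1 hp
    obtain ⟨hx, rfl⟩ := pair_mem_graphOn.1 hf
    exact pair_mem_graphOn.2 ⟨h hx, (hFF'.1 hx).symm⟩
  · intro hp
    obtain ⟨y, hy, rfl⟩ := mem_graphOn.1 hp
    exact pair_mem_inv.2 (pair_mem_graphOn.2 ⟨h' hy, (hFF'.2 hy).symm⟩)

theorem idOn_eq_graphOn (D : ZFSet.{u}) : idOn D = graphOn id D := by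
  ext p
  rw [idOn, ZFSet.mem_sep, mem_graphOn]
  constructor
  · rintro ⟨hp, x, rfl⟩
    exact ⟨x, (ZFSet.pair_mem_prod.1 hp).1, rfl⟩
  · rintro ⟨x, hx, rfl⟩
    exact ⟨ZFSet.pair_mem_prod.2 ⟨hx, hx⟩, x, rfl⟩

theorem restrict_graphOn (h : D ⊆ E) : restrict (graphOn F E) D = graphOn F D := by
  ext p
  rw [restrict, ZFSet.mem_sep, mem_graphOn, mem_graphOn]
  constructor
  · rintro ⟨⟨x, -, rfl⟩, y, hy, z, hz⟩
    exact ⟨x, (ZFSet.pair_inj.1 hz).1 ▸ hy, rfl⟩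
  · rintro ⟨x, hx, rfl⟩
    exact ⟨⟨x, h hx, rfl⟩, x, hx, F x, rfl⟩

theorem isFunc_iff : ZFSet.IsFunc D E f ↔ ∃ F, Set.MapsTo F D E ∧ f = graphOn F D := by
  constructor
  · rintro ⟨hsub, h⟩
    have h_val (x : ZFSet.{u}) : ∃ y, x ∈ D → ZFSet.pair x y ∈ f := by
      by_cases hx : x ∈ D
      · exact (h x hx).exists.imp fun _ hy _ => hy
      · exact ⟨∅, fun hx' => absurd hx' hx⟩
    choose F hF using h_val
    refine ⟨F, fun x hx => (ZFSet.pair_mem_prod.1 (hsub (hF x hx))).2, ZFSet.ext fun p => ?_⟩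
    rw [mem_graphOn]
    constructor
    · intro hp
      obtain ⟨x, hx, y, -, rfl⟩ := ZFSet.mem_prod.1 (hsub hp)
      exact ⟨x, hx, by rw [(h x hx).unique hp (hF x hx)]⟩
    · rintro ⟨x, hx, rfl⟩
      exact hF x hx
  · rintro ⟨F, hF, rfl⟩
    exact ⟨graphOn_subset_prod hF, fun x hx =>
      ⟨F x, pair_mem_graphOn.2 ⟨hx, rfl⟩, fun _ hy => (pair_mem_graphOn.1 hy).2⟩⟩

theorem isBij_graphOn_iff : IsBij D E (graphOn F D) ↔ Set.BijOn F D E := by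
  constructor
  · rintro ⟨hf, h⟩
    obtain ⟨F', hF', hFF'⟩ := isFunc_iff.1 hf
    refine ⟨hF'.congr (graphOn_inj.1 hFF').symm, fun x hx y hy hxy => ?_, fun y hy => ?_⟩
    · exact (h (F x) (hF'.congr (graphOn_inj.1 hFF').symm hx)).unique
        (pair_mem_graphOn.2 ⟨hx, rfl⟩) (pair_mem_graphOn.2 ⟨hy, hxy⟩)
    · obtain ⟨x, hx⟩ := (h y hy).exists
      exact ⟨x, (pair_mem_graphOn.1 hx).1, (pair_mem_graphOn.1 hx).2.symm⟩
  · intro hF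
    refine ⟨isFunc_iff.2 ⟨F, hF.mapsTo, rfl⟩, fun y hy => ?_⟩
    obtain ⟨x, hx, rfl⟩ := hF.surjOn hy
    refine ⟨x, pair_mem_graphOn.2 ⟨hx, rfl⟩, fun x' hx' => ?_⟩
    obtain ⟨hx', h⟩ := pair_mem_graphOn.1 hx'
    exact (hF.injOn hx hx' h).symm

theorem isBij_iff : IsBij D E f ↔ ∃ F, Set.BijOn F D E ∧ f = graphOn F D := by
  constructor
  · intro h
    obtain ⟨F, -, rfl⟩ := isFunc_iff.1 h.1
    exact ⟨F, isBij_graphOn_iff.1 h, rfl⟩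
  · rintro ⟨F, hF, rfl⟩
    exact isBij_graphOn_iff.2 hF

theorem exists_bijOn_range {ι : Type*} [Small.{u} ι] {t t' : ι → ZFSet.{u}}
    (ht : Function.Injective t) (ht' : Function.Injective t') :
    ∃ F, Set.BijOn F (ZFSet.range t) (ZFSet.range t') ∧ ∀ i, F (t i) = t' i := by
  refine ⟨Function.extend t t' id, ⟨?_, ?_, ?_⟩, fun i => ht.extend_apply _ _ i⟩
  · rintro _ hx
    obtain ⟨i, rfl⟩ := ZFSet.mem_range.1 hx
    exact ZFSet.mem_range.2 ⟨i, (ht.extend_apply _ _ i).symm⟩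
  · rintro _ hx _ hy hxy
    obtain ⟨i, rfl⟩ := ZFSet.mem_range.1 hx
    obtain ⟨j, rfl⟩ := ZFSet.mem_range.1 hy
    rw [ht.extend_apply, ht.extend_apply] at hxy
    rw [ht' hxy]
  · rintro _ hy
    obtain ⟨i, rfl⟩ := ZFSet.mem_range.1 hy
    exact ⟨t i, ZFSet.mem_range.2 ⟨i, rfl⟩, ht.extend_apply _ _ i⟩

variable {M : Set ZFSet.{u}} [hM : IsTransitiveModelWeakZF M]

theorem idOn_mem (hD : D ∈ M) : idOn D ∈ M :=
  (DefinableFun.image (f := fun _ : Empty → M => idOn D) (F := fun _ d => ZFSet.pair d d)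
    (.const hD) ((DefinableFun.var none).pair (.var none)) fun _ _ => by
      rw [idOn_eq_graphOn, mem_graphOn]; rfl).mem Empty.elim

end Graph

section Tuple

/-- The von Neumann numerals. -/
def num : ℕ → ZFSet.{u}
  | 0 => ∅
  | n + 1 => insert (num n) (num n)

theorem num_eq_range (n : ℕ) : num n = ZFSet.range fun i : Fin n => num.{u} i := by
  induction n with
  | zero => ext; simp [num]
  | succ n ih =>
    ext x
    have hx : x ∈ num n ↔ ∃ i : Fin n, num i = x := by rw [ih, ZFSet.mem_range]
    rw [num, ZFSet.mem_insert_iff, hx, ZFSet.mem_range, Fin.exists_fin_succ', or_comm]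
    exact or_congr Iff.rfl eq_comm

variable {n : ℕ} {D E : ZFSet.{u}} {t t' : Fin n → ZFSet.{u}}

theorem num_mem_num {i n : ℕ} (h : i < n) : num.{u} i ∈ num n := by
  rw [num_eq_range]
  exact ZFSet.mem_range.2 ⟨⟨i, h⟩, rfl⟩

theorem num_injective : Function.Injective num.{u} :=
  Function.Injective.of_lt_imp_ne fun _ _ h h' =>
    ZFSet.mem_irrefl _ (h' ▸ num_mem_num h)

theorem num_mem_omega (n : ℕ) : num n ∈ ZFSet.omega := by
  induction n with
  | zero => exact ZFSet.omega_zero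
  | succ n ih => exact ZFSet.omega_succ ih

theorem num_one : num 1 = {∅} :=
  LawfulSingleton.insert_empty_eq ∅

/-- The tuple with entries `t i`, as a function on a numeral. -/
noncomputable def tup (t : Fin n → ZFSet.{u}) : ZFSet.{u} :=
  ZFSet.range fun i : Fin n => ZFSet.pair (num i) (t i)

theorem tup_zero (t : Fin 0 → ZFSet.{u}) : tup t = ∅ :=
  (ZFSet.eq_empty _).2 fun _ h => (ZFSet.mem_range.1 h).elim fun i _ => i.elim0

theorem tup_snoc (t : Fin n → ZFSet.{u}) (a : ZFSet.{u}) :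
    tup (Fin.snoc t a : Fin (n + 1) → ZFSet.{u}) = insert (ZFSet.pair (num n) a) (tup t) := by
  ext x
  simp [tup, Fin.exists_fin_succ', or_comm, eq_comm]

theorem num_pair_mem_tup {i : Fin n} {y : ZFSet.{u}} : ZFSet.pair (num i) y ∈ tup t ↔ y = t i := by
  simp only [tup, ZFSet.mem_range, ZFSet.pair_inj]
  refine ⟨fun ⟨j, hj, h⟩ => ?_, fun h => ⟨i, rfl, h.symm⟩⟩
  rw [← h, Fin.ext (num_injective hj)]

theorem tup_injective : Function.Injective (tup : (Fin n → ZFSet.{u}) → ZFSet.{u}) :=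
  fun _ _ h => funext fun _ => num_pair_mem_tup.1 (h ▸ num_pair_mem_tup.2 rfl : _ ∈ tup _)

theorem tup_eq_graphOn {F : ZFSet.{u} → ZFSet.{u}} (h : ∀ i : Fin n, F (num i) = t i) :
    tup t = graphOn F (num n) := by
  simp only [num_eq_range n, graphOn_range, h, tup]

theorem mem_funs_num {x : ZFSet.{u}} :
    x ∈ ZFSet.funs (num n) D ↔ ∃ t : Fin n → ZFSet.{u}, (∀ i, t i ∈ D) ∧ x = tup t := by
  rw [ZFSet.mem_funs, isFunc_iff]
  constructor
  · rintro ⟨F, hF, rfl⟩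
    exact ⟨fun i : Fin n => F (num i), fun i => hF (num_mem_num i.2),
      (tup_eq_graphOn fun _ => rfl).symm⟩
  · rintro ⟨t, ht, rfl⟩
    have h_inj : Function.Injective fun i : Fin n => num.{u} i :=
      num_injective.comp Fin.val_injective
    refine ⟨Function.extend (fun i : Fin n => num i) t id, fun x hx => ?_,
      tup_eq_graphOn (h_inj.extend_apply t id)⟩
    rw [SetLike.mem_coe, num_eq_range, ZFSet.mem_range] at hx
    obtain ⟨i, rfl⟩ := hx
    rw [h_inj.extend_apply]
    exact ht i

theorem tup_mem_funs : tup t ∈ ZFSet.funs (num n) D ↔ ∀ i, t i ∈ D :=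
  mem_funs_num.trans ⟨fun ⟨_, h, h'⟩ => tup_injective h' ▸ h, fun h => ⟨t, h, rfl⟩⟩

theorem funs_num_mono (h : D ⊆ E) : ZFSet.funs (num n) D ⊆ ZFSet.funs (num n) E := fun x hx => by
  obtain ⟨t, ht, rfl⟩ := mem_funs_num.1 hx
  exact tup_mem_funs.2 fun i => h (ht i)

theorem comp_tup {F : ZFSet.{u} → ZFSet.{u}} (ht : ∀ i, t i ∈ D) :
    comp (graphOn F D) (tup t) = tup (F ∘ t) := by
  obtain ⟨T, hT, h⟩ := isFunc_iff.1 (ZFSet.mem_funs.1 (tup_mem_funs.2 ht))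
  have hTt (i : Fin n) : T (num i) = t i :=
    num_pair_mem_tup.1 (h ▸ pair_mem_graphOn.2 ⟨num_mem_num i.2, rfl⟩)
  rw [h, comp_graphOn hT, tup_eq_graphOn]
  exact fun i => congrArg F (hTt i)

theorem singleton_pair_eq_tup (b : ZFSet.{u}) :
    ({ZFSet.pair ∅ b} : ZFSet.{u}) = tup fun _ : Fin 1 => b := by
  ext p
  simp [tup, num, eq_comm]

variable {M : Set ZFSet.{u}} [hM : IsTransitiveModelWeakZF M] {α : Type*}

theorem num_mem (n : ℕ) : num n ∈ M := by
  induction n with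
  | zero => exact empty_mem
  | succ n ih => exact ((DefinableFun.const ih).insert (.const ih)).mem Empty.elim

theorem DefinableFun.tup {f : Fin n → (α → M) → ZFSet.{u}} (hf : ∀ i, DefinableFun (f i)) :
    DefinableFun fun v => tup fun i => f i v :=
  .range fun i : Fin n => (DefinableFun.const (num_mem i)).pair (hf i)

theorem definableFun_funs (n : ℕ) {D : (α → M) → ZFSet.{u}} (hD : DefinableFun D) :
    DefinableFun fun v => ZFSet.funs (num n) (D v) := by
  induction n with
  | zero =>
    have h (D : ZFSet.{u}) : ZFSet.funs (num 0) D = {∅} := ZFSet.ext fun x => by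
      rw [mem_funs_num, ZFSet.mem_singleton, ← tup_zero Fin.elim0]
      exact ⟨fun ⟨t, _, hx⟩ => hx.trans (congrArg _ (Subsingleton.elim _ _)),
        fun hx => ⟨_, fun i => i.elim0, hx⟩⟩
    simp only [h]
    exact (DefinableFun.const empty_mem).singleton
  | succ n ih =>
    let row (v : α → M) (d : ZFSet.{u}) : ZFSet.{u} := ZFSet.range
      fun y : ZFSet.funs (num n) (D v) => (insert (ZFSet.pair (num n) d) y : ZFSet.{u})
    have h_row : DefinableFun fun w : Option α → M => row (fun i => w (some i)) (w none) :=
      (ih.reindex some).image (F := fun w y => insert (ZFSet.pair (num n) (w none)) y)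
        (((DefinableFun.const (num_mem n)).pair (.var _)).insert (.var _)) fun w x => by
          simp [row, eq_comm]
    refine .biUnion hD h_row fun v x => ?_
    simp only [row, ZFSet.mem_range, Subtype.exists, mem_funs_num]
    constructor
    · rintro ⟨t, ht, rfl⟩
      refine ⟨t (Fin.last n), ht _, _, ⟨t ∘ Fin.castSucc, fun i => ht i.castSucc, rfl⟩, ?_⟩
      exact (tup_snoc _ _).symm.trans (congrArg tup (Fin.snoc_init_self t))
    · rintro ⟨d, hd, _, ⟨t, ht, rfl⟩, rfl⟩
      refine ⟨Fin.snoc t d, Fin.forall_fin_succ'.2 ⟨?_, ?_⟩, (tup_snoc _ _).symm⟩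
      · simpa only [Fin.snoc_castSucc] using ht
      · simpa only [Fin.snoc_last] using hd

theorem tup_mem (ht : ∀ i, t i ∈ M) : tup t ∈ M :=
  (DefinableFun.tup fun i => .const (ht i)).mem Empty.elim

end Tuple

/-! ### Relational structures and orbits -/

section RelationalLanguages

/-- A finite relational language, with symbols indexed by `ι`: the symbol with index `i` has arity
`ar i` and is named by the von Neumann number `nm i`. -/
structure RelLang (ι : Type) where
  ar : ι → ℕ
  nm : ι ↪ ℕ

namespace RelLang

variable {ι κ : Type} (Λ : RelLang ι) (φ : κ ↪ ι)

/-- The sublanguage that consists of the symbols with index in the range of `φ`. -/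
def comap : RelLang κ where
  ar := Λ.ar ∘ φ
  nm := φ.trans Λ.nm

/-- The relation symbol with index `i`, as a set. -/
def sym (i : ι) : ZFSet.{u} := relSym (num (Λ.ar i)) (num (Λ.nm i))

/-- The language, as a set. -/
noncomputable def lang : ZFSet.{u} := ZFSet.range Λ.sym

/-- The structure with domain `D` in which the symbol with index `i` is interpreted as `v i`. -/
noncomputable def str (D : ZFSet.{u}) (v : ι → ZFSet.{u}) : Str.{u} :=
  ⟨D, ZFSet.range fun i => ZFSet.pair (Λ.sym i) (v i)⟩

variable {Λ φ}

theorem relSym_eq_sym {n a : ZFSet.{u}} {i : ι} :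
    relSym n a = Λ.sym i ↔ n = num (Λ.ar i) ∧ a = num (Λ.nm i) := by
  simp only [sym, relSym, ZFSet.pair_inj, true_and]

theorem sym_injective : Function.Injective (Λ.sym : ι → ZFSet.{u}) := fun _ _ h =>
  Λ.nm.injective (num_injective (relSym_eq_sym.1 h).2)

theorem mem_lang {s : ZFSet.{u}} : s ∈ Λ.lang ↔ ∃ i, Λ.sym i = s :=
  ZFSet.mem_range

theorem sym_mem_lang (i : ι) : (Λ.sym i : ZFSet.{u}) ∈ Λ.lang :=
  mem_lang.2 ⟨i, rfl⟩

theorem lang_comap_subset : ((Λ.comap φ).lang : ZFSet.{u}) ⊆ Λ.lang := fun s hs => by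
  obtain ⟨i, rfl⟩ := mem_lang.1 hs
  exact sym_mem_lang (φ i)

theorem sym_mem_lang_comap {i : ι} : (Λ.sym i : ZFSet.{u}) ∈ (Λ.comap φ).lang ↔ i ∈ Set.range φ :=
  mem_lang.trans <| exists_congr fun j => sym_injective.eq_iff (a := φ j)

theorem funSym_notMem_lang (n a : ZFSet.{u}) : funSym n a ∉ Λ.lang := fun h => by
  obtain ⟨i, hi⟩ := mem_lang.1 h
  exact absurd (ZFSet.mem_singleton.2 rfl) ((ZFSet.eq_empty _).1 (ZFSet.pair_inj.1 hi).1.symm ∅)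

theorem isLanguage_lang : IsLanguage (Λ.lang : ZFSet.{u}) := fun s hs => by
  obtain ⟨i, rfl⟩ := mem_lang.1 hs
  exact ⟨_, num_mem_omega _, _, Or.inl rfl⟩

variable {X D E : ZFSet.{u}} {v w : ι → ZFSet.{u}}

theorem interprets_str {i : ι} {x : ZFSet.{u}} :
    (Λ.str D v).Interprets (Λ.sym i) x ↔ x = v i := by
  simp only [Str.Interprets, str, ZFSet.mem_range, ZFSet.pair_inj]
  refine ⟨?_, fun h => ⟨i, rfl, h.symm⟩⟩
  rintro ⟨j, hj, rfl⟩
  rw [sym_injective hj]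

theorem str_inj : Λ.str D v = Λ.str E w ↔ D = E ∧ v = w := by
  refine ⟨fun h => ⟨congrArg Str.dom h, funext fun i => ?_⟩, fun ⟨hD, hv⟩ => hD ▸ hv ▸ rfl⟩
  exact interprets_str.1 (h ▸ interprets_str.2 rfl)

theorem isStr_str (hD : D.Nonempty) (hv : ∀ i, v i ⊆ ZFSet.funs (num (Λ.ar i)) D) :
    IsStr Λ.lang (Λ.str D v) where
  nonempty := hD
  interp_subset p hp := by
    obtain ⟨i, rfl⟩ := ZFSet.mem_range.1 hp
    exact ⟨_, sym_mem_lang i, _, rfl⟩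
  interp_unique s hs := by
    obtain ⟨i, rfl⟩ := mem_lang.1 hs
    exact ⟨v i, interprets_str.2 rfl, fun x hx => interprets_str.1 hx⟩
  rel n a x hs hx := by
    obtain ⟨i, hi⟩ := mem_lang.1 hs
    obtain ⟨rfl, rfl⟩ := relSym_eq_sym.1 hi.symm
    exact interprets_str.1 hx ▸ hv i
  func n a x h := absurd h (funSym_notMem_lang n a)

theorem exists_eq_str {A : Str.{u}} (h : IsStr Λ.lang A) :
    ∃ v, A = Λ.str A.dom v ∧ ∀ i, v i ⊆ ZFSet.funs (num (Λ.ar i)) A.dom := by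
  choose v hv hu using fun i => h.interp_unique _ (sym_mem_lang i)
  refine ⟨v, Str.ext rfl (ZFSet.ext fun p => ⟨fun hp => ZFSet.mem_range.2 ?_, fun hp => ?_⟩),
    fun i => h.rel _ _ _ (sym_mem_lang i) (hv i)⟩
  · obtain ⟨s, hs, x, rfl⟩ := h.interp_subset p hp
    obtain ⟨i, rfl⟩ := mem_lang.1 hs
    exact ⟨i, by rw [hu i x hp]⟩
  · obtain ⟨i, rfl⟩ := ZFSet.mem_range.1 hp
    exact hv i

theorem isIso_str_iff {F : ZFSet.{u} → ZFSet.{u}} :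
    IsIso Λ.lang (Λ.str D v) (Λ.str E w) (graphOn F D) ↔
      Set.BijOn F D E ∧ ∀ i, ∀ t : Fin (Λ.ar i) → ZFSet.{u}, (∀ j, t j ∈ D) →
        (tup t ∈ v i ↔ tup (F ∘ t) ∈ w i) := by
  constructor
  · refine fun h => ⟨isBij_graphOn_iff.1 h.bij, fun i t ht => ?_⟩
    rw [← comp_tup ht]
    exact h.rel _ _ _ _ (sym_mem_lang i) (interprets_str.2 rfl) (interprets_str.2 rfl) _
      (tup_mem_funs.2 ht)
  · rintro ⟨hF, h⟩
    refine ⟨isBij_graphOn_iff.2 hF, fun n a x y hs hx hy t ht => ?_,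
      fun n a x y hs => absurd hs (funSym_notMem_lang n a)⟩
    obtain ⟨i, hi⟩ := mem_lang.1 hs
    obtain ⟨rfl, rfl⟩ := relSym_eq_sym.1 hi.symm
    obtain ⟨t, ht', rfl⟩ := mem_funs_num.1 ht
    rw [interprets_str.1 hx, interprets_str.1 hy, h i t ht', comp_tup (D := D) ht']

theorem predSet_str {i : ι} (hv : v i = ZFSet.funs (num 1) D) (hDX : D ⊆ X) :
    (Λ.str X v).predSet (Λ.sym i) = D := by
  ext b
  simp only [Str.predSet, ZFSet.mem_sep, interprets_str, exists_eq_left, hv,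
    singleton_pair_eq_tup, tup_mem_funs, forall_const]
  exact and_iff_right_of_imp fun hb => hDX hb

theorem isMinus_str_iff {i : ι} {A : Str.{u}} (hv : v i = ZFSet.funs (num 1) D) (hDX : D ⊆ X)
    (hD : D.Nonempty) (hφ : ∀ k, v (φ k) ⊆ ZFSet.funs (num (Λ.ar (φ k))) D) :
    IsMinus (Λ.comap φ).lang (Λ.sym i) (Λ.str X v) A ↔ A = (Λ.comap φ).str D (v ∘ φ) := by
  constructor
  · intro h
    obtain ⟨w, hA, hw⟩ := exists_eq_str h.isStr
    have hdom : A.dom = D := h.dom_eq.trans (predSet_str hv hDX)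
    rw [hdom] at hA hw
    refine hA.trans (congrArg _ <| funext fun k => ZFSet.ext fun t => ?_)
    have h_iff (ht : t ∈ ZFSet.funs (num (Λ.ar (φ k))) D) : t ∈ w k ↔ t ∈ v (φ k) :=
      h.rel _ _ _ _ (sym_mem_lang k) (hA ▸ interprets_str.2 rfl) (interprets_str (i := φ k).2 rfl)
        _ (hdom ▸ ht)
    exact ⟨fun ht => (h_iff (hw k ht)).1 ht, fun ht => (h_iff (hφ k ht)).2 ht⟩
  · rintro rfl
    refine ⟨isStr_str hD hφ, (predSet_str hv hDX).symm, fun n a x y hs hx hy t _ => ?_,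
      fun n a x y hs => absurd hs (funSym_notMem_lang n a)⟩
    obtain ⟨k, hk⟩ := mem_lang.1 hs
    obtain ⟨rfl, rfl⟩ := relSym_eq_sym.1 hk.symm
    rw [interprets_str.1 hx, interprets_str (i := φ k).1 hy]
    rfl

variable {M : Set ZFSet.{u}} [hM : IsTransitiveModelWeakZF M] {α : Type*}

theorem sym_mem (i : ι) : Λ.sym i ∈ M :=
  pair_mem empty_mem (pair_mem (num_mem _) (num_mem _))

variable [Finite ι]

theorem lang_mem : Λ.lang ∈ M :=
  range_mem sym_mem

theorem definableFun_code {f : (α → M) → ZFSet.{u}} {g : ι → (α → M) → ZFSet.{u}}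
    (hf : DefinableFun f) (hg : ∀ i, DefinableFun (g i)) :
    DefinableFun fun v => (Λ.str (f v) fun i => g i v).code :=
  hf.pair <| .range fun i => (DefinableFun.const (sym_mem i)).pair (hg i)

theorem code_mem_iff : (Λ.str D v).code ∈ M ↔ D ∈ M ∧ ∀ i, v i ∈ M := by
  refine ⟨fun h => ?_, fun ⟨hD, hv⟩ =>
    (definableFun_code (.const hD) fun i => .const (hv i)).mem Empty.elim⟩
  obtain ⟨hD, hI⟩ := of_pair_mem h
  exact ⟨hD, fun i => (of_pair_mem (mem_of_mem hI (ZFSet.mem_range.2 ⟨i, rfl⟩))).2⟩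

end RelLang

theorem Str.code_injective : Function.Injective Str.code.{u} := fun _ _ h =>
  Str.ext (ZFSet.pair_inj.1 h).1 (ZFSet.pair_inj.1 h).2

end RelationalLanguages

section Orbits

variable {Γ : Type} [Group Γ] {k : ℕ} {σ : Γ →* Equiv.Perm (Fin k)} {t s : Fin k → ZFSet.{u}}
  {D E : ZFSet.{u}} {F : ZFSet.{u} → ZFSet.{u}}

/-- The orbit of the tuple `t` under rearrangements by the permutations `σ g`. If `t` is injective
and `σ` is faithful then this is a torsor under `Γ`. -/
noncomputable def orb (σ : Γ →* Equiv.Perm (Fin k)) (t : Fin k → ZFSet.{u}) : ZFSet.{u} :=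
  ZFSet.range fun g : Γ => tup (t ∘ σ g)

theorem tup_mem_orb : tup s ∈ orb σ t ↔ ∃ g, s = t ∘ σ g := by
  simp only [orb, ZFSet.mem_range, tup_injective.eq_iff, eq_comm]

theorem self_mem_orb : tup t ∈ orb σ t :=
  tup_mem_orb.2 ⟨1, by simp⟩

theorem orb_subset_funs (ht : ∀ i, t i ∈ D) : orb σ t ⊆ ZFSet.funs (num k) D := fun x hx => by
  obtain ⟨g, rfl⟩ := ZFSet.mem_range.1 hx
  exact tup_mem_funs.2 fun i => ht _

theorem orb_comp_perm (g : Γ) : orb σ (t ∘ σ g) = orb σ t := by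
  have h (g' : Γ) : tup ((t ∘ σ g) ∘ σ g') = tup (t ∘ σ (g * g')) := by
    rw [map_mul, Equiv.Perm.coe_mul, Function.comp_assoc]
  ext x
  simp only [orb, ZFSet.mem_range, h]
  exact (Equiv.mulLeft g).exists_congr_left.trans (by simp)

theorem tup_comp_mem_orb_iff (hF : Set.InjOn F D) (ht : ∀ i, t i ∈ D) (hs : ∀ i, s i ∈ D) :
    tup (F ∘ s) ∈ orb σ (F ∘ t) ↔ tup s ∈ orb σ t := by
  simp only [tup_mem_orb]
  refine exists_congr fun g => ⟨fun h => funext fun i => hF (hs i) (ht _) (congrFun h i), ?_⟩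
  rintro rfl
  rfl

theorem eq_orb_comp (hF : Set.BijOn F D E) (ht : ∀ i, t i ∈ D) {r : ZFSet.{u}}
    (hr : r ⊆ ZFSet.funs (num k) E)
    (h : ∀ s : Fin k → ZFSet.{u}, (∀ i, s i ∈ D) → (tup s ∈ orb σ t ↔ tup (F ∘ s) ∈ r)) :
    r = orb σ (F ∘ t) := by
  have h_iff {x : ZFSet.{u}} (hx : x ∈ ZFSet.funs (num k) E) : x ∈ r ↔ x ∈ orb σ (F ∘ t) := by
    obtain ⟨s, hs, rfl⟩ := mem_funs_num.1 hx
    choose s' hs' hFs using fun i => hF.surjOn (hs i)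
    obtain rfl : F ∘ s' = s := funext hFs
    rw [← h s' hs', tup_comp_mem_orb_iff hF.injOn ht hs']
  exact ZFSet.ext fun x => ⟨fun hx => (h_iff (hr hx)).1 hx,
    fun hx => (h_iff (orb_subset_funs (fun i => hF.mapsTo (ht i)) hx)).2 hx⟩

theorem DefinableFun.orb {M : Set ZFSet.{u}} [IsTransitiveModelWeakZF M] [Finite Γ] {α : Type*}
    {f : Fin k → (α → M) → ZFSet.{u}} (hf : ∀ i, DefinableFun (f i)) :
    DefinableFun fun v => orb σ fun i => f i v :=
  .range fun _ => .tup fun _ => hf _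

end Orbits

/-! ### Torsors and their extensions -/

theorem bijOn_iff_forall_mem_iff {β β' : Type*} {f : β → β'} {s s₁ : Set β}
    {t t₁ : Set β'} (hf : Set.BijOn f s t) (hs : s₁ ⊆ s) (ht : t₁ ⊆ t) :
    Set.BijOn f s₁ t₁ ↔ ∀ x ∈ s, (x ∈ s₁ ↔ f x ∈ t₁) := by
  constructor
  · rintro h x hx
    rw [← h.image_eq, hf.injOn.mem_image_iff hs hx]
  · refine fun h => ⟨fun x hx => (h x (hs hx)).1 hx, hf.injOn.mono hs, fun y hy => ?_⟩
    obtain ⟨x, hx, rfl⟩ := hf.surjOn (ht hy)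
    exact ⟨x, (h x hx).2 hy, rfl⟩

/-- A surjection `ν : G → H` of finite groups, with faithful actions `ρ` of `H` on `n` points and
`γ` of `G` on `n + m` points such that `γ` acts on the first `n` points through `ν` and `ρ`. -/
structure PermExt where
  n : ℕ
  m : ℕ
  n_pos : 0 < n
  G : Type
  H : Type
  [groupG : Group G]
  [groupH : Group H]
  [finiteG : Finite G]
  [finiteH : Finite H]
  ν : G →* H
  ν_surjective : Function.Surjective ν
  ρ : H →* Equiv.Perm (Fin n)
  γ : G →* Equiv.Perm (Fin (n + m))
  ρ_injective : Function.Injective ρ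
  γ_injective : Function.Injective γ
  γ_castAdd : ∀ g i, γ g (Fin.castAdd m i) = Fin.castAdd m (ρ (ν g) i)

namespace PermExt

attribute [instance] groupG groupH finiteG finiteH

variable {Ξ : PermExt} {M : Set ZFSet.{u}} {α : Type*}

theorem γ_comp_castAdd (g : Ξ.G) :
    Ξ.γ g ∘ Fin.castAdd Ξ.m = Fin.castAdd Ξ.m ∘ Ξ.ρ (Ξ.ν g) :=
  funext (Ξ.γ_castAdd g)

theorem exists_γ_natAdd (g : Ξ.G) (j : Fin Ξ.m) :
    ∃ j', Ξ.γ g (Fin.natAdd Ξ.n j) = Fin.natAdd Ξ.n j' := by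
  induction h : Ξ.γ g (Fin.natAdd Ξ.n j) using Fin.addCases with
  | right j' => exact ⟨j', rfl⟩
  | left i =>
    have hi : Ξ.γ g (Fin.castAdd Ξ.m ((Ξ.ρ (Ξ.ν g)).symm i)) = Fin.castAdd Ξ.m i := by
      rw [Ξ.γ_castAdd, Equiv.apply_symm_apply]
    have := congrArg Fin.val ((Ξ.γ g).injective (h.trans hi.symm))
    simp only [Fin.val_natAdd, Fin.val_castAdd] at this
    omega

section Structures

variable (Ξ)

/-- The language of the graph: the torsor on the base, a binary relation on the base, the torsor
on the whole domain, and the unary symbol for the base. -/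
def highLang : RelLang (Fin 4) where
  ar := ![Ξ.n, 2, Ξ.n + Ξ.m, 1]
  nm := Fin.valEmbedding

/-- The language of the base: its torsor and its binary relation. -/
def lowLang : RelLang (Fin 2) :=
  Ξ.highLang.comap (Fin.castLEEmb (by norm_num))

/-- The base structure on `D` with torsor `r` and binary relation `e`. -/
noncomputable def base (D r e : ZFSet.{u}) : Str.{u} :=
  Ξ.lowLang.str D ![r, e]

/-- The structure on `X` with torsor `R` and with the base structure on `D` given by `r` and `e`. -/
noncomputable def total (X D r e R : ZFSet.{u}) : Str.{u} :=
  Ξ.highLang.str X ![r, e, R, ZFSet.funs (num 1) D]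

variable {Ξ} {X Y D E r r' e e' R R' : ZFSet.{u}} {F : ZFSet.{u} → ZFSet.{u}}

theorem base_inj : Ξ.base D r e = Ξ.base E r' e' ↔ D = E ∧ r = r' ∧ e = e' := by
  simp [base, RelLang.str_inj]

theorem exists_eq_base {A : Str.{u}} (h : IsStr Ξ.lowLang.lang A) :
    ∃ r e, A = Ξ.base A.dom r e ∧ r ⊆ ZFSet.funs (num Ξ.n) A.dom ∧
      e ⊆ ZFSet.funs (num 2) A.dom := by
  obtain ⟨v, hA, hv⟩ := RelLang.exists_eq_str h
  exact ⟨v 0, v 1, hA.trans (congrArg _ (List.ofFn_inj.1 rfl)), hv 0, hv 1⟩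

theorem isStr_total (hX : X.Nonempty) (hDX : D ⊆ X) (hr : r ⊆ ZFSet.funs (num Ξ.n) D)
    (he : e ⊆ ZFSet.funs (num 2) D) (hR : R ⊆ ZFSet.funs (num (Ξ.n + Ξ.m)) X) :
    IsStr Ξ.highLang.lang (Ξ.total X D r e R) :=
  RelLang.isStr_str hX <| Fin.forall_fin_succ.2
    ⟨hr.trans (funs_num_mono hDX), Fin.forall_fin_succ.2 ⟨he.trans (funs_num_mono hDX),
      Fin.forall_fin_two.2 ⟨hR, funs_num_mono hDX⟩⟩⟩

theorem isMinus_total_iff {A : Str.{u}} (hD : D.Nonempty) (hDX : D ⊆ X)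
    (hr : r ⊆ ZFSet.funs (num Ξ.n) D) (he : e ⊆ ZFSet.funs (num 2) D) :
    IsMinus Ξ.lowLang.lang (Ξ.highLang.sym 3) (Ξ.total X D r e R) A ↔ A = Ξ.base D r e := by
  refine (RelLang.isMinus_str_iff rfl hDX hD (Fin.forall_fin_two.2 ⟨hr, he⟩)).trans ?_
  exact Eq.congr_right (congrArg _ (List.ofFn_inj.1 rfl))

theorem isIso_base_iff :
    IsIso Ξ.lowLang.lang (Ξ.base D r e) (Ξ.base E r' e') (graphOn F D) ↔
      Set.BijOn F D E ∧
      (∀ t : Fin Ξ.n → ZFSet.{u}, (∀ i, t i ∈ D) → (tup t ∈ r ↔ tup (F ∘ t) ∈ r')) ∧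
      ∀ t : Fin 2 → ZFSet.{u}, (∀ i, t i ∈ D) → (tup t ∈ e ↔ tup (F ∘ t) ∈ e') := by
  rw [base, base, RelLang.isIso_str_iff, Fin.forall_fin_two]
  rfl

theorem forall_tup_iff_of_subset {k : ℕ} {v w : ZFSet.{u}} (hDX : D ⊆ X)
    (hF : ∀ x ∈ X, (x ∈ D ↔ F x ∈ E)) (hv : v ⊆ ZFSet.funs (num k) D)
    (hw : w ⊆ ZFSet.funs (num k) E) :
    (∀ t : Fin k → ZFSet.{u}, (∀ i, t i ∈ X) → (tup t ∈ v ↔ tup (F ∘ t) ∈ w)) ↔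
      ∀ t : Fin k → ZFSet.{u}, (∀ i, t i ∈ D) → (tup t ∈ v ↔ tup (F ∘ t) ∈ w) := by
  refine ⟨fun h t ht => h t fun i => hDX (ht i), fun h t ht => ?_⟩
  by_cases htD : ∀ i, t i ∈ D
  · exact h t htD
  · refine iff_of_false (fun htv => htD (tup_mem_funs.1 (hv htv))) fun htw => htD fun i => ?_
    exact (hF _ (ht i)).2 (tup_mem_funs.1 (hw htw) i)

theorem isIso_total_iff (hDX : D ⊆ X) (hr : r ⊆ ZFSet.funs (num Ξ.n) D)
    (he : e ⊆ ZFSet.funs (num 2) D) (hEY : E ⊆ Y) (hr' : r' ⊆ ZFSet.funs (num Ξ.n) E)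
    (he' : e' ⊆ ZFSet.funs (num 2) E) :
    IsIso Ξ.highLang.lang (Ξ.total X D r e R) (Ξ.total Y E r' e' R') (graphOn F X) ↔
      Set.BijOn F X Y ∧ IsIso Ξ.lowLang.lang (Ξ.base D r e) (Ξ.base E r' e') (graphOn F D) ∧
      ∀ t : Fin (Ξ.n + Ξ.m) → ZFSet.{u}, (∀ i, t i ∈ X) → (tup t ∈ R ↔ tup (F ∘ t) ∈ R') := by
  have h_unary : (∀ t : Fin 1 → ZFSet.{u}, (∀ i, t i ∈ X) →
      (tup t ∈ ZFSet.funs (num 1) D ↔ tup (F ∘ t) ∈ ZFSet.funs (num 1) E)) ↔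
      ∀ x ∈ X, (x ∈ D ↔ F x ∈ E) := by
    simp only [tup_mem_funs, Unique.forall_iff, Function.comp_apply]
    exact ⟨fun h x hx => h (fun _ => x) hx, fun h t => h (t default)⟩
  rw [total, total, RelLang.isIso_str_iff]
  refine and_congr_right fun hF => ?_
  rw [isIso_base_iff, bijOn_iff_forall_mem_iff hF hDX hEY, Fin.forall_fin_succ,
    Fin.forall_fin_succ, Fin.forall_fin_two]
  change (∀ t : Fin Ξ.n → ZFSet.{u}, (∀ i, t i ∈ X) → (tup t ∈ r ↔ tup (F ∘ t) ∈ r')) ∧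
    (∀ t : Fin 2 → ZFSet.{u}, (∀ i, t i ∈ X) → (tup t ∈ e ↔ tup (F ∘ t) ∈ e')) ∧
    (∀ t : Fin (Ξ.n + Ξ.m) → ZFSet.{u}, (∀ i, t i ∈ X) → (tup t ∈ R ↔ tup (F ∘ t) ∈ R')) ∧
    (∀ t : Fin 1 → ZFSet.{u}, (∀ i, t i ∈ X) →
      (tup t ∈ ZFSet.funs (num 1) D ↔ tup (F ∘ t) ∈ ZFSet.funs (num 1) E)) ↔ _
  rw [h_unary]
  constructor
  · rintro ⟨h_r, h_e, h_R, h⟩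
    exact ⟨⟨h, (forall_tup_iff_of_subset hDX h hr hr').1 h_r,
      (forall_tup_iff_of_subset hDX h he he').1 h_e⟩, h_R⟩
  · rintro ⟨⟨h, h_r, h_e⟩, h_R⟩
    exact ⟨(forall_tup_iff_of_subset hDX h hr hr').2 h_r,
      (forall_tup_iff_of_subset hDX h he he').2 h_e, h_R, h⟩

variable [hM : IsTransitiveModelWeakZF M]

theorem base_code_mem_iff : (Ξ.base D r e).code ∈ M ↔ D ∈ M ∧ r ∈ M ∧ e ∈ M := by
  rw [base, RelLang.code_mem_iff, Fin.forall_fin_two]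
  rfl

theorem definableFun_base {D r e : (α → M) → ZFSet.{u}} (hD : DefinableFun D)
    (hr : DefinableFun r) (he : DefinableFun e) :
    DefinableFun fun v => (Ξ.base (D v) (r v) (e v)).code :=
  RelLang.definableFun_code (g := fun i v => ![r v, e v] i) hD <| Fin.forall_fin_two.2 ⟨hr, he⟩

theorem definableFun_total {X D r e R : (α → M) → ZFSet.{u}} (hX : DefinableFun X)
    (hD : DefinableFun D) (hr : DefinableFun r) (he : DefinableFun e) (hR : DefinableFun R) :
    DefinableFun fun v => (Ξ.total (X v) (D v) (r v) (e v) (R v)).code :=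
  RelLang.definableFun_code (g := fun i v => ![r v, e v, R v, ZFSet.funs (num 1) (D v)] i) hX <|
    Fin.forall_fin_succ.2 ⟨hr, Fin.forall_fin_succ.2 ⟨he, Fin.forall_fin_two.2
      ⟨hR, definableFun_funs 1 hD⟩⟩⟩

end Structures

end PermExt

theorem exists_bijOn_union {β β' : Type*} {F G : β → β'} {s₁ s₂ : Set β} {t₁ t₂ : Set β'}
    (hF : Set.BijOn F s₁ t₁) (hG : Set.BijOn G s₂ t₂) (hs : Disjoint s₁ s₂)
    (ht : Disjoint t₁ t₂) :
    ∃ F', Set.EqOn F' F s₁ ∧ Set.EqOn F' G s₂ ∧ Set.BijOn F' (s₁ ∪ s₂) (t₁ ∪ t₂) := by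
  classical
  have h₁ : Set.EqOn (s₁.piecewise F G) F s₁ := s₁.piecewise_eqOn F G
  have h₂ : Set.EqOn (s₁.piecewise F G) G s₂ :=
    (s₁.piecewise_eqOn_compl F G).mono hs.subset_compl_left
  refine ⟨_, h₁, h₂, (hF.congr h₁.symm).union (hG.congr h₂.symm) ?_⟩
  refine (Set.injOn_union hs).2 ⟨hF.injOn.congr h₁.symm, hG.injOn.congr h₂.symm, ?_⟩
  intro x hx y hy
  rw [h₁ hx, h₂ hy]
  exact ht.ne_of_mem (hF.mapsTo hx) (hG.mapsTo hy)

theorem definable_injective {M : Set ZFSet.{u}} {α ι : Type*} [Finite ι]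
    {f : ι → (α → M) → ZFSet.{u}} (hf : ∀ i, DefinableFun (f i)) :
    Definable fun v => Function.Injective fun i => f i v :=
  (Definable.forall_index fun i => Definable.forall_index fun j =>
    ((hf i).definable_eq (hf j)).imp (.const (i = j))).congr fun _ => Iff.rfl

theorem exists_injective_notMem {M : Set ZFSet.{u}} [IsTransitiveModelWeakZF M] {D : ZFSet.{u}}
    (hD : D ∈ M) (k : ℕ) :
    ∃ t : Fin k → ZFSet.{u}, Function.Injective t ∧ ∀ j, t j ∈ M ∧ t j ∉ D := by
  refine ⟨fun j => ZFSet.pair D (num j), fun i j h => Fin.ext (num_injective ?_), fun j =>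
    ⟨pair_mem hD (num_mem j), fun h => ?_⟩⟩
  · exact (ZFSet.pair_inj.1 h).2
  · have h₁ : D ∈ ({D} : ZFSet.{u}) := ZFSet.mem_singleton.2 rfl
    have h₂ : ({D} : ZFSet.{u}) ∈ ZFSet.pair D (num j) := by simp [ZFSet.pair]
    exact ((ZFSet.rank_lt_of_mem h₁).trans (ZFSet.rank_lt_of_mem h₂)).not_gt
      (ZFSet.rank_lt_of_mem h)

namespace PermExt

variable {Ξ : PermExt} {M : Set ZFSet.{u}} {α : Type*}
  {X Y D E r r' e e' R R' : ZFSet.{u}} {F : ZFSet.{u} → ZFSet.{u}}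

section Torsors

variable (Ξ)

/-- `r` is the `H`-torsor generated by some injective enumeration of `n` points of `D`. -/
def IsTorsor (D r : ZFSet.{u}) : Prop :=
  ∃ t : Fin Ξ.n → ZFSet.{u}, Function.Injective t ∧ (∀ i, t i ∈ D) ∧ r = orb Ξ.ρ t

/-- `X` arises from `D` by adding `m` points, in such a way that `t` enumerates `n` points of `D`
followed by the new points, and `r` and `R` are the torsors of the two enumerations. -/
structure Enumerates (X D r R : ZFSet.{u}) (t : Fin (Ξ.n + Ξ.m) → ZFSet.{u}) : Prop where
  injective : Function.Injective t
  castAdd_mem : ∀ i, t (Fin.castAdd Ξ.m i) ∈ D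
  natAdd_notMem : ∀ j, t (Fin.natAdd Ξ.n j) ∉ D
  r_eq : r = orb Ξ.ρ (t ∘ Fin.castAdd Ξ.m)
  R_eq : R = orb Ξ.γ t
  X_eq : X = D ∪ ZFSet.range t

/-- `X` arises from `D` by adding `m` points, and the `G`-torsor `R` lies over the `H`-torsor `r`;
these data are the graph of the construction. -/
def Extends (X D r R : ZFSet.{u}) : Prop := ∃ t, Ξ.Enumerates X D r R t

variable {Ξ}

theorem IsTorsor.subset_funs (h : Ξ.IsTorsor D r) : r ⊆ ZFSet.funs (num Ξ.n) D := by
  obtain ⟨t, -, ht, rfl⟩ := h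
  exact orb_subset_funs ht

theorem IsTorsor.nonempty (h : Ξ.IsTorsor D r) : D.Nonempty := by
  obtain ⟨t, -, ht, -⟩ := h
  exact ⟨_, ht ⟨0, Ξ.n_pos⟩⟩

theorem IsTorsor.of_bijOn (h : Ξ.IsTorsor D r) (hF : Set.BijOn F D E)
    (hr' : r' ⊆ ZFSet.funs (num Ξ.n) E)
    (hrr' : ∀ t : Fin Ξ.n → ZFSet.{u}, (∀ i, t i ∈ D) → (tup t ∈ r ↔ tup (F ∘ t) ∈ r')) :
    Ξ.IsTorsor E r' := by
  obtain ⟨t, ht, htD, rfl⟩ := h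
  exact ⟨F ∘ t, fun i j h => ht (hF.injOn (htD i) (htD j) h), fun i => hF.mapsTo (htD i),
    eq_orb_comp hF htD hr' hrr'⟩

namespace Enumerates

variable {t t' : Fin (Ξ.n + Ξ.m) → ZFSet.{u}}

theorem subset (h : Ξ.Enumerates X D r R t) : D ⊆ X := fun _ hx =>
  h.X_eq ▸ ZFSet.mem_union.2 (.inl hx)

theorem mem (h : Ξ.Enumerates X D r R t) (i : Fin (Ξ.n + Ξ.m)) : t i ∈ X :=
  h.X_eq ▸ ZFSet.mem_union.2 (.inr (ZFSet.mem_range.2 ⟨i, rfl⟩))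

theorem isTorsor (h : Ξ.Enumerates X D r R t) : Ξ.IsTorsor D r :=
  ⟨_, h.injective.comp (Fin.castAdd_injective _ _), h.castAdd_mem, h.r_eq⟩

theorem coe_X_eq (h : Ξ.Enumerates X D r R t) :
    (X : Set ZFSet.{u}) = ↑D ∪ ↑(ZFSet.range (t ∘ Fin.natAdd Ξ.n) : ZFSet.{u}) := by
  refine Set.Subset.antisymm (fun x hx => ?_) (Set.union_subset h.subset fun x hx => ?_)
  · rcases ZFSet.mem_union.1 (h.X_eq ▸ hx) with hx | hx
    · exact .inl hx
    · obtain ⟨i, rfl⟩ := ZFSet.mem_range.1 hx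
      induction i using Fin.addCases with
      | left i => exact .inl (h.castAdd_mem i)
      | right j => exact .inr (ZFSet.mem_range.2 ⟨j, rfl⟩)
  · obtain ⟨j, rfl⟩ := ZFSet.mem_range.1 hx
    exact h.mem _

theorem comp_perm (h : Ξ.Enumerates X D r R t) (g : Ξ.G) :
    Ξ.Enumerates X D r R (t ∘ Ξ.γ g) where
  injective := h.injective.comp (Ξ.γ g).injective
  castAdd_mem i := by
    rw [Function.comp_apply, Ξ.γ_castAdd]
    exact h.castAdd_mem _
  natAdd_notMem j := by
    obtain ⟨j', hj'⟩ := exists_γ_natAdd g j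
    rw [Function.comp_apply, hj']
    exact h.natAdd_notMem j'
  r_eq := by
    rw [Function.comp_assoc, γ_comp_castAdd, ← Function.comp_assoc, orb_comp_perm, h.r_eq]
  R_eq := by rw [orb_comp_perm, h.R_eq]
  X_eq := h.X_eq.trans <| congrArg _ <| SetLike.coe_injective <| by
    simp only [ZFSet.coe_range, (Ξ.γ g).surjective.range_comp]

theorem exists_bijOn (h : Ξ.Enumerates X D r R t) (h' : Ξ.Enumerates Y E r' R' t')
    (hF : Set.BijOn F D E) (htt' : F ∘ t ∘ Fin.castAdd Ξ.m = t' ∘ Fin.castAdd Ξ.m) :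
    ∃ F', Set.EqOn F' F D ∧ Set.BijOn F' X Y ∧ F' ∘ t = t' := by
  obtain ⟨G, hG, hGt⟩ := exists_bijOn_range (h.injective.comp (Fin.natAdd_injective Ξ.m Ξ.n))
    (h'.injective.comp (Fin.natAdd_injective Ξ.m Ξ.n))
  have disj {X D r R : ZFSet.{u}} {t : Fin (Ξ.n + Ξ.m) → ZFSet.{u}}
      (h : Ξ.Enumerates X D r R t) :
      Disjoint (D : Set ZFSet.{u}) (ZFSet.range (t ∘ Fin.natAdd Ξ.n)) := by
    rw [ZFSet.coe_range, Set.disjoint_right, Set.forall_mem_range]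
    exact h.natAdd_notMem
  obtain ⟨F', hF'F, hF'G, hF'⟩ := exists_bijOn_union hF hG (disj h) (disj h')
  rw [← h.coe_X_eq, ← h'.coe_X_eq] at hF'
  refine ⟨F', hF'F, hF', funext <| (Fin.forall_fin_add _).2 ⟨fun i => ?_, fun j => ?_⟩⟩
  · exact (hF'F (h.castAdd_mem i)).trans (congrFun htt' i)
  · exact (hF'G (ZFSet.mem_range.2 ⟨j, rfl⟩)).trans (hGt j)

end Enumerates

theorem Extends.exists_enumerates (h : Ξ.Extends X D r R) {s : Fin Ξ.n → ZFSet.{u}}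
    (hs : tup s ∈ r) : ∃ t, Ξ.Enumerates X D r R t ∧ t ∘ Fin.castAdd Ξ.m = s := by
  obtain ⟨t, ht⟩ := h
  obtain ⟨a, rfl⟩ := tup_mem_orb.1 (ht.r_eq ▸ hs)
  obtain ⟨g, rfl⟩ := Ξ.ν_surjective a
  refine ⟨_, ht.comp_perm g, ?_⟩
  rw [Function.comp_assoc, γ_comp_castAdd, Function.comp_assoc]

variable [hM : IsTransitiveModelWeakZF M]

theorem definable_extends {X D r R : (α → M) → ZFSet.{u}} (hX : DefinableFun X)
    (hD : DefinableFun D) (hr : DefinableFun r) (hR : DefinableFun R) :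
    Definable fun v => Ξ.Extends (X v) (D v) (r v) (R v) := by
  have ht (i : Fin (Ξ.n + Ξ.m)) :
      DefinableFun fun w : α ⊕ Fin (Ξ.n + Ξ.m) → M => (w (Sum.inr i) : ZFSet.{u}) := .var _
  have hD' := hD.reindex (Sum.inl (β := Fin (Ξ.n + Ξ.m)))
  have castAdd_mem := Definable.forall_index fun i : Fin Ξ.n =>
    (ht (i.castAdd Ξ.m)).definable_mem hD'
  have natAdd_notMem := Definable.forall_index fun j : Fin Ξ.m =>
    ((ht (j.natAdd Ξ.n)).definable_mem hD').not
  have r_eq := (hr.reindex Sum.inl).definable_eq (.orb (σ := Ξ.ρ) fun i => ht (i.castAdd Ξ.m))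
  have R_eq := (hR.reindex Sum.inl).definable_eq (.orb (σ := Ξ.γ) ht)
  have X_eq := (hX.reindex Sum.inl).definable_eq (hD'.union (.range ht))
  refine (Definable.exists_tuple (p := fun v t => Ξ.Enumerates (X v) (D v) (r v) (R v) t) <|
    ((definable_injective ht).and <| castAdd_mem.and <| natAdd_notMem.and <| r_eq.and <|
      R_eq.and X_eq).congr fun w => ?_).congr fun v => ?_
  · exact ⟨fun h => ⟨h.1, h.2, h.3, h.4, h.5, h.6⟩, fun ⟨h₁, h₂, h₃, h₄, h₅, h₆⟩ =>
      ⟨h₁, h₂, h₃, h₄, h₅, h₆⟩⟩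
  · refine exists_congr fun t => ?_
    exact (and_iff_right_of_imp fun h i => mem_of_mem (hX.mem v) (h.mem i)).symm

theorem IsTorsor.exists_extends (h : Ξ.IsTorsor D r) (hD : D ∈ M) :
    ∃ X ∈ M, ∃ R ∈ M, Ξ.Extends X D r R := by
  obtain ⟨s, hs, hsD, rfl⟩ := h
  obtain ⟨s', hs', hs'D⟩ := exists_injective_notMem hD Ξ.m
  let t : Fin (Ξ.n + Ξ.m) → ZFSet.{u} := Fin.append s s'
  have ht (i : Fin (Ξ.n + Ξ.m)) : t i ∈ M := by
    induction i using Fin.addCases with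
    | left i => simpa [t] using mem_of_mem hD (hsD i)
    | right j => simpa [t] using (hs'D j).1
  refine ⟨D ∪ ZFSet.range t, ((DefinableFun.const hD).union (.const (range_mem ht))).mem Empty.elim,
    orb Ξ.γ t, (DefinableFun.orb fun i => .const (ht i)).mem Empty.elim, t, ?_, fun i => ?_,
    fun j => ?_, ?_, rfl, rfl⟩
  · exact Fin.append_injective_iff.2 ⟨hs, hs', fun i j h => (hs'D j).2 (h ▸ hsD i)⟩
  · simpa [t] using hsD i
  · simpa [t] using (hs'D j).2
  · congr 1
    funext i
    simp [t]

theorem exists_isIso_total (hX : Ξ.Extends X D r R) (hY : Ξ.Extends Y E r' R')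
    (he : e ⊆ ZFSet.funs (num 2) D) (he' : e' ⊆ ZFSet.funs (num 2) E) (hXM : X ∈ M)
    (hYM : Y ∈ M) {f : ZFSet.{u}} (hfM : f ∈ M)
    (hf : IsIso Ξ.lowLang.lang (Ξ.base D r e) (Ξ.base E r' e') f) :
    ∃ g ∈ M, IsIso Ξ.highLang.lang (Ξ.total X D r e R) (Ξ.total Y E r' e' R') g ∧ f ⊆ g := by
  obtain ⟨t, ht⟩ := hX
  obtain ⟨F, hF, rfl⟩ := isBij_iff.1 hf.bij
  change Set.BijOn F D E at hF
  change graphOn F D ∈ M at hfM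
  change IsIso _ _ _ (graphOn F D) at hf
  have h_mem : tup (F ∘ t ∘ Fin.castAdd Ξ.m) ∈ r' :=
    ((isIso_base_iff.1 hf).2.1 _ ht.castAdd_mem).1 (ht.r_eq ▸ self_mem_orb)
  obtain ⟨t', ht', htt'⟩ := hY.exists_enumerates h_mem
  obtain ⟨F', hF'F, hF', rfl⟩ := ht.exists_bijOn ht' hF htt'.symm
  rw [← graphOn_inj.2 hF'F] at hf hfM
  have h_graph : graphOn F' X = graphOn F' D ∪ graphOn F' (ZFSet.range t) := by
    rw [ht.X_eq, graphOn_union]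
  refine ⟨graphOn F' X, ?_, ?_, ?_⟩
  · rw [h_graph, graphOn_range]
    exact ((DefinableFun.const hfM).union (.const (range_mem fun i =>
      pair_mem (mem_of_mem hXM (ht.mem i)) (mem_of_mem hYM (ht'.mem i))))).mem Empty.elim
  · refine (isIso_total_iff ht.subset ht.isTorsor.subset_funs he ht'.subset
      ht'.isTorsor.subset_funs he').2 ⟨hF', hf, fun s hs => ?_⟩
    rw [ht.R_eq, ht'.R_eq, tup_comp_mem_orb_iff hF'.injOn ht.mem hs]
  · change graphOn F D ⊆ _
    rw [← graphOn_inj.2 hF'F, h_graph]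
    exact fun p hp => ZFSet.mem_union.2 (.inl hp)

end Torsors

end PermExt

/-! ### The constructions attached to a surjection of finite groups -/

/-- A definable class of sets with a binary relation that is closed under isomorphism in `M`. -/
structure BinRelClass (M : Set ZFSet.{u}) where
  K : ZFSet.{u} → ZFSet.{u} → Prop
  definable : Definable fun v : Fin 2 → M => K (v 0) (v 1)
  subset_funs : ∀ D e, K D e → e ⊆ ZFSet.funs (num 2) D
  iso : ∀ D e E e' F, K D e → D ∈ M → E ∈ M → e' ⊆ ZFSet.funs (num 2) E →
    Set.BijOn F D E → graphOn F D ∈ M →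
    (∀ t : Fin 2 → ZFSet.{u}, (∀ i, t i ∈ D) → (tup t ∈ e ↔ tup (F ∘ t) ∈ e')) →
    K E e'

namespace PermExt

variable {Ξ : PermExt} {M : Set ZFSet.{u}} {𝒦 : BinRelClass M} {X D r e R : ZFSet.{u}}
  {A B : Str.{u}}

section Construction

variable (Ξ 𝒦)

/-- `B` is an extension of a structure in `𝒦` with a torsor. -/
def Graph (B : Str.{u}) : Prop :=
  ∃ X ∈ M, ∃ D ∈ M, ∃ r ∈ M, ∃ e ∈ M, ∃ R ∈ M,
    B = Ξ.total X D r e R ∧ 𝒦.K D e ∧ Ξ.Extends X D r R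

variable {Ξ 𝒦}

theorem Extends.isTorsor (h : Ξ.Extends X D r R) : Ξ.IsTorsor D r := by
  obtain ⟨t, ht⟩ := h
  exact ht.isTorsor

theorem Extends.subset (h : Ξ.Extends X D r R) : D ⊆ X := by
  obtain ⟨t, ht⟩ := h
  exact ht.subset

theorem Extends.isStr_total (h : Ξ.Extends X D r R) (he : e ⊆ ZFSet.funs (num 2) D) :
    IsStr Ξ.highLang.lang (Ξ.total X D r e R) := by
  obtain ⟨t, ht⟩ := h
  have hX : X.Nonempty := ht.isTorsor.nonempty.imp ht.subset
  exact PermExt.isStr_total hX ht.subset ht.isTorsor.subset_funs he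
    (ht.R_eq ▸ orb_subset_funs ht.mem)

theorem Extends.isMinus_iff (h : Ξ.Extends X D r R) (he : e ⊆ ZFSet.funs (num 2) D) :
    IsMinus Ξ.lowLang.lang (Ξ.highLang.sym 3) (Ξ.total X D r e R) A ↔ A = Ξ.base D r e :=
  isMinus_total_iff h.isTorsor.nonempty h.subset h.isTorsor.subset_funs he

theorem exists_holds₁_iff_mem {L : ZFSet.{u}} [IsTransitiveModelWeakZF M] (hL : L ∈ M) :
    ∃ φ : ParamFormula M 1, ∀ x, Holds₁ φ x ↔ x ∈ L := by
  obtain ⟨φ, hφ⟩ := Definable.exists_holds₁ (p := (· ∈ L))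
    ((DefinableFun.var (M := M) 0).definable_mem (.const hL))
  exact ⟨φ, fun x => (hφ x).trans (and_iff_right_of_imp (mem_of_mem hL))⟩

variable [hM : IsTransitiveModelWeakZF M]

theorem exists_holds₁_iff_graph (Ξ : PermExt) (𝒦 : BinRelClass M) :
    ∃ φ : ParamFormula M 1, ∀ x, Holds₁ φ x ↔ ∃ B, x = B.code ∧ Ξ.Graph 𝒦 B := by
  obtain ⟨φ, hφ⟩ := Definable.exists_holds₁ (M := M) (p := fun x =>
    ∃ X ∈ M, ∃ D ∈ M, ∃ r ∈ M, ∃ e ∈ M, ∃ R ∈ M,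
      x = (Ξ.total X D r e R).code ∧ 𝒦.K D e ∧ Ξ.Extends X D r R) <|
    .ex <| .ex <| .ex <| .ex <| .ex <| (DefinableFun.definable_eq (.var _)
      (definableFun_total (.var _) (.var _) (.var _) (.var _) (.var _))).and <|
      (𝒦.definable.reindex ![some (some (some none)), some none]).and <|
        definable_extends (.var _) (.var _) (.var _) (.var _)
  refine ⟨φ, fun x => (hφ x).trans ⟨?_, ?_⟩⟩
  · rintro ⟨_, X, hX, D, hD, r, hr, e, he, R, hR, rfl, h⟩
    exact ⟨_, rfl, X, hX, D, hD, r, hr, e, he, R, hR, rfl, h⟩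
  · rintro ⟨_, rfl, X, hX, D, hD, r, hr, e, he, R, hR, rfl, h⟩
    have h_mem : (Ξ.total X D r e R).code ∈ M := (definableFun_total (.const hX) (.const hD)
      (.const hr) (.const he) (.const hR)).mem Empty.elim
    exact ⟨h_mem, X, hX, D, hD, r, hr, e, he, R, hR, rfl, h⟩

variable (Ξ 𝒦) in
/-- The data of the construction that extends the structures in `𝒦` with a torsor. -/
noncomputable def constructionData : ConstructionData M where
  φ₁ := (exists_holds₁_iff_mem Ξ.highLang.lang_mem).choose
  φ₂ := (exists_holds₁_iff_mem Ξ.lowLang.lang_mem).choose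
  φ₃ := (exists_holds₁_iff_graph Ξ 𝒦).choose
  L := Ξ.highLang.lang
  L' := Ξ.lowLang.lang
  P := Ξ.highLang.sym 3

theorem inGraph_iff : (Ξ.constructionData 𝒦).InGraph B ↔ Ξ.Graph 𝒦 B := by
  refine ((exists_holds₁_iff_graph Ξ 𝒦).choose_spec _).trans ⟨?_, fun h => ⟨B, rfl, h⟩⟩
  rintro ⟨B', h, hB'⟩
  rwa [Str.code_injective h]

theorem inDomain_iff : (Ξ.constructionData 𝒦).InDomain A ↔
    ∃ D ∈ M, ∃ r ∈ M, ∃ e ∈ M, A = Ξ.base D r e ∧ 𝒦.K D e ∧ Ξ.IsTorsor D r := by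
  constructor
  · rintro ⟨B, hB, hA⟩
    obtain ⟨X, -, D, hD, r, hr, e, he, R, -, rfl, hK, hX⟩ := inGraph_iff.1 hB
    exact ⟨D, hD, r, hr, e, he, (hX.isMinus_iff (𝒦.subset_funs _ _ hK)).1 hA, hK, hX.isTorsor⟩
  · rintro ⟨D, hD, r, hr, e, he, rfl, hK, h⟩
    obtain ⟨X, hX, R, hR, h⟩ := h.exists_extends hD
    exact ⟨_, inGraph_iff.2 ⟨X, hX, D, hD, r, hr, e, he, R, hR, rfl, hK, h⟩,
      (h.isMinus_iff (𝒦.subset_funs _ _ hK)).2 rfl⟩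

variable (Ξ 𝒦) in
/-- The construction that extends the structures in `𝒦` with a torsor. -/
noncomputable def construction : Construction M where
  toConstructionData := Ξ.constructionData 𝒦
  L_mem := Ξ.highLang.lang_mem
  L'_mem := Ξ.lowLang.lang_mem
  L_isLanguage := Ξ.highLang.isLanguage_lang
  L'_isLanguage := Ξ.lowLang.isLanguage_lang
  φ₁_defines := (exists_holds₁_iff_mem Ξ.highLang.lang_mem).choose_spec
  φ₂_defines := (exists_holds₁_iff_mem Ξ.lowLang.lang_mem).choose_spec
  L'_subset := RelLang.lang_comap_subset
  P_mem := Ξ.highLang.sym_mem_lang 3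
  P_notMem h := by
    obtain ⟨i, hi⟩ := RelLang.sym_mem_lang_comap.1 h
    exact absurd (congrArg Fin.val hi) (by simp; omega)
  P_unary := ⟨num 3, by rw [← num_one]; rfl⟩
  graph_isStr x hx := by
    obtain ⟨B, rfl, X, -, D, -, r, -, e, -, R, -, rfl, hK, h⟩ :=
      ((exists_holds₁_iff_graph Ξ 𝒦).choose_spec x).1 hx
    exact ⟨_, rfl, h.isStr_total (𝒦.subset_funs _ _ hK)⟩
  exists_minus B hB := by
    obtain ⟨X, -, D, hD, r, hr, e, he, R, -, rfl, hK, h⟩ := inGraph_iff.1 hB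
    exact ⟨_, base_code_mem_iff.2 ⟨hD, hr, he⟩, (h.isMinus_iff (𝒦.subset_funs _ _ hK)).2 rfl⟩
  domain_closed A A' hA hA'M hA' := by
    rintro ⟨f, hfM, hf⟩
    obtain ⟨D, hD, r, -, e, -, rfl, hK, h⟩ := inDomain_iff.1 hA
    obtain ⟨r', e', hA'_eq, hr', he'⟩ := exists_eq_base hA'
    rw [hA'_eq] at hf hA'M ⊢
    obtain ⟨hEM, hr'M, he'M⟩ := base_code_mem_iff.1 hA'M
    obtain ⟨F, -, rfl⟩ := isBij_iff.1 hf.bij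
    obtain ⟨hF, h_r, h_e⟩ := isIso_base_iff.1 hf
    exact inDomain_iff.2 ⟨_, hEM, r', hr'M, e', he'M, rfl,
      𝒦.iso _ _ _ _ _ hK hD hEM he' hF hfM h_e, h.of_bijOn hF hr' h_r⟩
  extends_iso A B A₀ B₀ hA hB hA₀ hB₀ f hfM hf := by
    obtain ⟨X, hX, D, -, r, -, e, -, R, -, rfl, hK, h⟩ := inGraph_iff.1 hA
    obtain ⟨X', hX', E, -, r', -, e', -, R', -, rfl, hK', h'⟩ := inGraph_iff.1 hB
    obtain rfl := (h.isMinus_iff (𝒦.subset_funs _ _ hK)).1 hA₀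
    obtain rfl := (h'.isMinus_iff (𝒦.subset_funs _ _ hK')).1 hB₀
    exact exists_isIso_total h h' (𝒦.subset_funs _ _ hK) (𝒦.subset_funs _ _ hK') hX hX' hfM hf

end Construction

end PermExt

section FiniteBases

/-- The set `D` has exactly `n` elements. -/
def HasCard (n : ℕ) (D : ZFSet.{u}) : Prop :=
  ∃ t : Fin n → ZFSet.{u}, Function.Injective t ∧ D = ZFSet.range t

theorem HasCard.eq_range {n : ℕ} {D : ZFSet.{u}} {t : Fin n → ZFSet.{u}} (hD : HasCard n D)
    (ht : Function.Injective t) (htD : ∀ i, t i ∈ D) : D = ZFSet.range t := by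
  obtain ⟨s, hs, rfl⟩ := hD
  refine SetLike.coe_injective (Eq.symm ?_)
  rw [ZFSet.coe_range, ZFSet.coe_range]
  refine Set.eq_of_subset_of_ncard_le (Set.range_subset_iff.2 fun i => ?_) ?_ (Set.finite_range s)
  · exact ZFSet.mem_range.1 (htD i)
  · rw [← Set.image_univ, ← Set.image_univ, Set.ncard_image_of_injective _ hs,
      Set.ncard_image_of_injective _ ht]

theorem HasCard.of_bijOn {n : ℕ} {D E : ZFSet.{u}} {F : ZFSet.{u} → ZFSet.{u}}
    (hD : HasCard n D) (hF : Set.BijOn F D E) : HasCard n E := by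
  obtain ⟨t, ht, rfl⟩ := hD
  refine ⟨F ∘ t, fun i j hij => ht (hF.injOn ?_ ?_ hij), ?_⟩
  · exact ZFSet.mem_range.2 ⟨i, rfl⟩
  · exact ZFSet.mem_range.2 ⟨j, rfl⟩
  · rw [← SetLike.coe_set_eq, ← hF.image_eq, ZFSet.coe_range, ZFSet.coe_range, Set.range_comp]

theorem hasCard_num (n : ℕ) : HasCard n (num.{u} n) :=
  ⟨_, num_injective.comp Fin.val_injective, num_eq_range n⟩

theorem PermExt.isTorsor_num (Ξ : PermExt) :
    Ξ.IsTorsor (num.{u} Ξ.n) (orb Ξ.ρ fun i => num i) :=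
  ⟨_, num_injective.comp Fin.val_injective, fun i => num_mem_num i.2, rfl⟩

variable {M : Set ZFSet.{u}} [hM : IsTransitiveModelWeakZF M]

theorem definable_hasCard (n : ℕ) : Definable fun v : Fin 1 → M => HasCard n (v 0 : ZFSet.{u}) := by
  have ht (i : Fin n) : DefinableFun fun w : Fin 1 ⊕ Fin n → M => (w (Sum.inr i) : ZFSet.{u}) :=
    .var _
  have h := (definable_injective ht).and
    ((DefinableFun.var (M := M) (Sum.inl (0 : Fin 1))).definable_eq (.range ht))
  refine (Definable.exists_tuple (p := fun v t => Function.Injective t ∧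
    (v 0 : ZFSet.{u}) = ZFSet.range t) h).congr fun v => exists_congr fun t => ?_
  exact (and_iff_right_of_imp fun h i =>
    mem_of_mem (v 0).2 (h.2 ▸ ZFSet.mem_range.2 ⟨i, rfl⟩)).symm

/-- The class of `n`-element sets with the empty relation. -/
def BinRelClass.ofCard (n : ℕ) : BinRelClass M where
  K D e := HasCard n D ∧ e = ∅
  definable := ((definable_hasCard n).reindex ![0]).and
    ((DefinableFun.var _).definable_eq (.const empty_mem))
  subset_funs _ _ h := h.2 ▸ ZFSet.empty_subset _
  iso := by
    rintro _ _ E e' F ⟨hD, rfl⟩ - - he' hF - h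
    refine ⟨hD.of_bijOn hF, (ZFSet.eq_empty _).2 fun x hx => ?_⟩
    obtain ⟨s, hs, rfl⟩ := mem_funs_num.1 (he' hx)
    choose s' hs' hFs using fun i => hF.surjOn (hs i)
    obtain rfl : F ∘ s' = s := funext hFs
    exact ZFSet.notMem_empty _ ((h s' hs').2 hx)

theorem PermExt.exists_isIso_base_of_hasCard {Ξ : PermExt} {D E r r' : ZFSet.{u}} (hDM : D ∈ M)
    (hEM : E ∈ M) (hD : HasCard Ξ.n D) (hE : HasCard Ξ.n E) (hr : Ξ.IsTorsor D r)
    (hr' : Ξ.IsTorsor E r') :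
    ∃ f ∈ M, IsIso Ξ.lowLang.lang (Ξ.base D r ∅) (Ξ.base E r' ∅) f := by
  obtain ⟨s, hs, hsD, rfl⟩ := hr
  obtain ⟨s', hs', hsE, rfl⟩ := hr'
  obtain ⟨F, hF, hFs⟩ := exists_bijOn_range hs hs'
  obtain rfl := hD.eq_range hs hsD
  obtain rfl := hE.eq_range hs' hsE
  refine ⟨graphOn F (ZFSet.range s), ?_, isIso_base_iff.2 ⟨hF, fun t ht => ?_, fun t _ => ?_⟩⟩
  · rw [graphOn_range]
    simp only [hFs]
    exact range_mem fun i => pair_mem (mem_of_mem hDM (hsD i)) (mem_of_mem hEM (hsE i))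
  · rw [← tup_comp_mem_orb_iff hF.injOn hsD ht, show F ∘ s = s' from funext hFs]
  · exact iff_of_false (ZFSet.notMem_empty _) (ZFSet.notMem_empty _)

theorem PermExt.unitype_construction_ofCard (Ξ : PermExt) :
    (Ξ.construction (M := M) (.ofCard Ξ.n)).Unitype := by
  refine ⟨⟨_, inDomain_iff.2 ⟨num Ξ.n, num_mem _, _, ?_, ∅, empty_mem, rfl,
    ⟨hasCard_num _, rfl⟩, Ξ.isTorsor_num⟩⟩, fun A A' hA hA' => ?_⟩
  · exact (DefinableFun.orb fun i => .const (num_mem _)).mem Empty.elim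
  · obtain ⟨D, hDM, r, -, _, -, rfl, ⟨hD, rfl⟩, hr⟩ := inDomain_iff.1 hA
    obtain ⟨E, hEM, r', -, _, -, rfl, ⟨hE, rfl⟩, hr'⟩ := inDomain_iff.1 hA'
    exact exists_isIso_base_of_hasCard hDM hEM hD hE hr hr'

end FiniteBases

section WellFoundedBases

variable {M : Set ZFSet.{u}} {α : Type*} {D E T e e' : ZFSet.{u}} {F : ZFSet.{u} → ZFSet.{u}}

theorem tup_comp_pair (F : ZFSet.{u} → ZFSet.{u}) (a b : ZFSet.{u}) :
    tup (F ∘ ![a, b]) = tup ![F a, F b] :=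
  congrArg tup (List.ofFn_inj.1 rfl)

theorem tup_pair_inj {a b c d : ZFSet.{u}} : tup ![a, b] = tup ![c, d] ↔ a = c ∧ b = d := by
  rw [tup_injective.eq_iff, Matrix.vecCons_inj]
  simp

theorem DefinableFun.tup_pair [IsTransitiveModelWeakZF M] {f g : (α → M) → ZFSet.{u}}
    (hf : DefinableFun f) (hg : DefinableFun g) :
    DefinableFun fun v => NatDef.tup ![f v, g v] := by
  have h := DefinableFun.tup (f := ![f, g]) (Fin.forall_fin_two.2 ⟨hf, hg⟩)
  refine (funext fun v => congrArg NatDef.tup ?_ : _ = _) ▸ h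
  exact List.ofFn_inj.1 rfl

variable (M) in
/-- In `M`, the relation `e` on `D` is extensional and well-founded. -/
structure IsWellFoundedExtensional (D e : ZFSet.{u}) : Prop where
  subset_funs : e ⊆ ZFSet.funs (num 2) D
  ext : ∀ a ∈ D, ∀ b ∈ D, (∀ c ∈ D, tup ![c, a] ∈ e ↔ tup ![c, b] ∈ e) → a = b
  exists_minimal : ∀ S ∈ M, S ⊆ D → S.Nonempty → ∃ a ∈ S, ∀ b ∈ S, tup ![b, a] ∉ e

/-- The membership relation on `T`, as a set of pairs. -/
noncomputable def memRel (T : ZFSet.{u}) : ZFSet.{u} :=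
  ZFSet.sep (fun z => ∃ b ∈ T, ∃ a ∈ b, z = tup ![a, b]) (ZFSet.funs (num 2) T)

theorem tup_pair_mem_memRel {a b : ZFSet.{u}} :
    tup ![a, b] ∈ memRel T ↔ a ∈ T ∧ b ∈ T ∧ a ∈ b := by
  simp only [memRel, ZFSet.mem_sep, tup_mem_funs, tup_pair_inj, Fin.forall_fin_two]
  constructor
  · rintro ⟨⟨ha, hb⟩, b', -, a', hab, rfl, rfl⟩
    exact ⟨ha, hb, hab⟩
  · exact fun ⟨ha, hb, hab⟩ => ⟨⟨ha, hb⟩, b, hb, a, hab, rfl, rfl⟩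

theorem isWellFoundedExtensional_memRel (hT : T.IsTransitive) :
    IsWellFoundedExtensional M T (memRel T) where
  subset_funs _ hz := (ZFSet.mem_sep.1 hz).1
  ext a ha b hb h := ZFSet.ext fun c => by
    have h' (hc : c ∈ T) : c ∈ a ↔ c ∈ b := by
      simpa only [tup_pair_mem_memRel, ha, hb, hc, true_and] using h c hc
    exact ⟨fun hc => (h' (hT a ha hc)).1 hc, fun hc => (h' (hT b hb hc)).2 hc⟩
  exists_minimal S _ _ hS := by
    obtain ⟨a, ha, h⟩ := ZFSet.regularity S (by rintro rfl; simp at hS)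
    refine ⟨a, ha, fun b hb hba => ZFSet.notMem_empty b (h ▸ ZFSet.mem_inter.2 ⟨hb, ?_⟩)⟩
    exact (tup_pair_mem_memRel.1 hba).2.2

variable [hM : IsTransitiveModelWeakZF M]

theorem DefinableFun.memRel {f : (α → M) → ZFSet.{u}} (hf : DefinableFun f) :
    DefinableFun fun v => NatDef.memRel (f v) :=
  (definableFun_funs 2 hf).sep <| Definable.exMem (hf.reindex some) <|
    Definable.exMem (DefinableFun.var none) <|
      (DefinableFun.var (some (some none))).definable_eq ((DefinableFun.var none).tup_pair (.var _))

theorem definable_isWellFoundedExtensional :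
    Definable fun v : Fin 2 → M => IsWellFoundedExtensional M (v 0 : ZFSet.{u}) (v 1) := by
  have h_subset : Definable fun v : Fin 2 → M => (v 1 : ZFSet.{u}) ⊆ ZFSet.funs (num 2) (v 0) :=
    (DefinableFun.var 1).definable_subset (definableFun_funs 2 (.var 0))
  have h_ext : Definable fun v : Fin 2 → M => ∀ a ∈ (v 0 : ZFSet.{u}), ∀ b ∈ (v 0 : ZFSet.{u}),
      (∀ c ∈ (v 0 : ZFSet.{u}), tup ![c, a] ∈ (v 1 : ZFSet.{u}) ↔ tup ![c, b] ∈ (v 1 : ZFSet.{u})) →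
        a = b :=
    .allMem (.var 0) <| .allMem (.var (some 0)) <| .imp
      (.allMem (.var (some (some 0))) <|
        (((DefinableFun.var none).tup_pair (.var _)).definable_mem (.var _)).iff
          (((DefinableFun.var none).tup_pair (.var _)).definable_mem (.var _)))
      ((DefinableFun.var _).definable_eq (.var _))
  have h_minimal : Definable fun v : Fin 2 → M => ∀ S ∈ M, S ⊆ (v 0 : ZFSet.{u}) → S.Nonempty →
      ∃ a ∈ S, ∀ b ∈ S, tup ![b, a] ∉ (v 1 : ZFSet.{u}) :=
    .all <| ((DefinableFun.var none).definable_subset (.var _)).imp <|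
      ((Definable.exMem (p := fun _ _ => True) (.var none) (.const _)).congr fun v =>
        exists_congr fun x => (and_true _).symm.to_iff).imp <|
        .exMem (.var none) <| .allMem (.var (some none)) <|
          (((DefinableFun.var none).tup_pair (.var _)).definable_mem (.var _)).not
  exact (h_subset.and (h_ext.and h_minimal)).congr fun v =>
    ⟨fun h => ⟨h.1, h.2, h.3⟩, fun ⟨h₁, h₂, h₃⟩ => ⟨h₁, h₂, h₃⟩⟩

theorem IsWellFoundedExtensional.of_bijOn (h : IsWellFoundedExtensional M D e)
    (hDM : D ∈ M) (he' : e' ⊆ ZFSet.funs (num 2) E) (hF : Set.BijOn F D E)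
    (hFM : graphOn F D ∈ M)
    (hFe : ∀ t : Fin 2 → ZFSet.{u}, (∀ i, t i ∈ D) → (tup t ∈ e ↔ tup (F ∘ t) ∈ e')) :
    IsWellFoundedExtensional M E e' := by
  have hFe' {a b : ZFSet.{u}} (ha : a ∈ D) (hb : b ∈ D) :
      tup ![a, b] ∈ e ↔ tup ![F a, F b] ∈ e' := by
    rw [hFe _ (Fin.forall_fin_two.2 ⟨ha, hb⟩), tup_comp_pair]
  refine ⟨he', fun a' ha b' hb hab => ?_, fun S' hS' hS'E ⟨y, hy⟩ => ?_⟩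
  · obtain ⟨a, haD, rfl⟩ := hF.surjOn ha
    obtain ⟨b, hbD, rfl⟩ := hF.surjOn hb
    refine congrArg F (h.ext a haD b hbD fun c hc => ?_)
    rw [hFe' hc haD, hFe' hc hbD]
    exact hab _ (hF.mapsTo hc)
  · let S := ZFSet.sep (fun x => ∃ y ∈ S', ZFSet.pair x y ∈ graphOn F D) D
    have mem_S {x : ZFSet.{u}} : x ∈ S ↔ x ∈ D ∧ F x ∈ S' := by
      simp only [S, ZFSet.mem_sep, pair_mem_graphOn]
      exact ⟨fun ⟨hx, _, hy, _, h⟩ => ⟨hx, h ▸ hy⟩, fun ⟨hx, h⟩ => ⟨hx, _, h, hx, rfl⟩⟩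
    have hS : S ∈ M := sep_mem (.exMem (.const hS') <|
      ((DefinableFun.var _).pair (.var none)).definable_mem (.const hFM)) hDM
    obtain ⟨x, hx, rfl⟩ := hF.surjOn (hS'E hy)
    obtain ⟨a, ha, h_min⟩ :=
      h.exists_minimal S hS (fun z hz => (mem_S.1 hz).1) ⟨x, mem_S.2 ⟨hx, hy⟩⟩
    refine ⟨F a, (mem_S.1 ha).2, fun b hb => ?_⟩
    obtain ⟨b, hbD, rfl⟩ := hF.surjOn (hS'E hb)
    rw [← hFe' hbD (mem_S.1 ha).1]
    exact h_min b (mem_S.2 ⟨hbD, hb⟩)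

theorem IsWellFoundedExtensional.eqOn_id (h : IsWellFoundedExtensional M D e) (hDM : D ∈ M)
    (hF : Set.BijOn F D D) (hFM : graphOn F D ∈ M)
    (hFe : ∀ t : Fin 2 → ZFSet.{u}, (∀ i, t i ∈ D) → (tup t ∈ e ↔ tup (F ∘ t) ∈ e)) :
    Set.EqOn F id D := by
  have hFe' {a b : ZFSet.{u}} (ha : a ∈ D) (hb : b ∈ D) :
      tup ![a, b] ∈ e ↔ tup ![F a, F b] ∈ e := by
    rw [hFe _ (Fin.forall_fin_two.2 ⟨ha, hb⟩), tup_comp_pair]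
  let S := ZFSet.sep (fun x => ZFSet.pair x x ∉ graphOn F D) D
  have mem_S {x : ZFSet.{u}} (hx : x ∈ D) : x ∈ S ↔ F x ≠ x := by
    simp [S, ZFSet.mem_sep, pair_mem_graphOn, hx, eq_comm]
  have hSD : S ⊆ D := fun x hx => (ZFSet.mem_sep.1 hx).1
  have hS : S ∈ M := sep_mem
    (((DefinableFun.var 0).pair (.var 0)).definable_mem (.const hFM)).not hDM
  by_contra h_ne
  obtain ⟨x, hx, hxF⟩ : ∃ x ∈ D, F x ≠ x := by simpa [Set.EqOn] using h_ne
  obtain ⟨a, ha, h_min⟩ := h.exists_minimal S hS hSD ⟨x, (mem_S hx).2 hxF⟩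
  have h_fix {c : ZFSet.{u}} (hc : c ∈ D) (hca : tup ![c, a] ∈ e) : F c = c :=
    not_not.1 fun hcF => h_min c ((mem_S hc).2 hcF) hca
  refine (mem_S (hSD ha)).1 ha (h.ext _ (hF.mapsTo (hSD ha)) _ (hSD ha) fun c hc => ⟨fun hca => ?_,
    fun hca => ?_⟩)
  · obtain ⟨c', hc', rfl⟩ := hF.surjOn hc
    have hca' := (hFe' hc' (hSD ha)).2 hca
    rwa [h_fix hc' hca']
  · rw [← h_fix hc hca]
    exact (hFe' hc (hSD ha)).1 hca

/-- The class of sets with an extensional relation that is well-founded in `M`. -/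
def BinRelClass.wellFoundedExtensional : BinRelClass M where
  K := IsWellFoundedExtensional M
  definable := definable_isWellFoundedExtensional
  subset_funs _ _ h := h.subset_funs
  iso _ _ _ _ _ h hDM _ he' hF hFM hFe := h.of_bijOn hDM he' hF hFM hFe

namespace PermExt

variable (Ξ : PermExt)

theorem rigidBased_construction_wellFoundedExtensional :
    (Ξ.construction (M := M) .wellFoundedExtensional).RigidBased := by
  intro B A hB hA f hfM hf
  obtain ⟨D, hDM, r, -, e, -, rfl, hK, -⟩ := inDomain_iff.1 ⟨B, hB, hA⟩
  obtain ⟨F, hF, rfl⟩ := isBij_iff.1 hf.bij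
  rw [idOn_eq_graphOn]
  exact graphOn_inj.2 (hK.eqOn_id hDM hF hfM (isIso_base_iff.1 hf).2.2)

end PermExt

end WellFoundedBases

/-! ### Transfer of uniformisations -/

section RigidBased

variable {M : Set ZFSet.{u}} {L t n : ZFSet.{u}} {A B : Str.{u}}

theorem Construction.InGraph.isStr {C : Construction M} (hB : C.InGraph B) : IsStr C.L B := by
  obtain ⟨B', hB', h⟩ := C.graph_isStr _ hB
  rwa [Str.code_injective hB']

theorem comp_idOn_of_mem_funs {D : ZFSet.{u}} (ht : t ∈ ZFSet.funs n D) : comp (idOn D) t = t := by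
  obtain ⟨F, hF, rfl⟩ := isFunc_iff.1 (ZFSet.mem_funs.1 ht)
  rw [idOn_eq_graphOn, comp_graphOn hF, Function.id_comp]

theorem IsStr.isIso_idOn (hB : IsStr L B) : IsIso L B B (idOn B.dom) where
  bij := by
    rw [idOn_eq_graphOn]
    exact isBij_graphOn_iff.2 (Set.bijOn_id _)
  rel n a v w hs hv hw t ht := by
    rw [(hB.interp_unique _ hs).unique hv hw, comp_idOn_of_mem_funs ht]
  func n a v w hs hv hw t ht x y htx hxy := by
    rw [idOn_eq_graphOn, pair_mem_graphOn] at hxy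
    rwa [← (hB.interp_unique _ hs).unique hv hw, comp_idOn_of_mem_funs ht, hxy.2]

variable [hM : IsTransitiveModelWeakZF M]

theorem IsStr.idOn_mem_autSet (hB : IsStr L B) (hBM : B.dom ∈ M) : idOn B.dom ∈ autSet M L B :=
  ZFSet.mem_sep.2 ⟨ZFSet.mem_powerset.2 ZFSet.sep_subset, idOn_mem hBM, hB.isIso_idOn⟩

theorem ConstructionData.InGraph.dom_mem {C : ConstructionData M} (hB : C.InGraph B) :
    B.dom ∈ M :=
  (of_pair_mem hB.1).1

theorem Construction.RigidBased.natural {C : Construction M} (hC : C.RigidBased) : C.Natural := by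
  intro B A hB hA
  have hAB : A.dom ⊆ B.dom := hA.dom_eq ▸ ZFSet.sep_subset
  have hBM : B.dom ∈ M := ConstructionData.InGraph.dom_mem hB
  have hAM : A.dom ∈ M := by
    obtain ⟨A', hA'M, hA'⟩ := C.exists_minus B hB
    rw [hA.dom_eq, ← hA'.dom_eq]
    exact (of_pair_mem hA'M).1
  have h_eq {h : ZFSet.{u}} (hh : h ∈ autSet M C.L' A) : h = idOn A.dom :=
    hC B A hB hA h (ZFSet.mem_sep.1 hh).2.1 (ZFSet.mem_sep.1 hh).2.2
  have h_graph (p : ZFSet.{u}) : p ∈ ({ZFSet.pair (idOn A.dom) (idOn B.dom)} : ZFSet.{u}) ↔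
      ∃ h ∈ autSet M C.L' A, p = ZFSet.pair h (idOn B.dom) := by
    rw [ZFSet.mem_singleton]
    refine ⟨fun hp => ⟨_, hA.isStr.idOn_mem_autSet hAM, hp⟩, ?_⟩
    rintro ⟨h, hh, rfl⟩
    rw [h_eq hh]
  refine ⟨fun _ => idOn B.dom, ⟨fun _ _ => (InGraph.isStr hB).idOn_mem_autSet hBM, _, ?_, h_graph⟩,
    fun h hh => ?_, fun _ _ _ _ => ?_⟩
  · exact (DefinableFun.const (pair_mem (idOn_mem hAM) (idOn_mem hBM))).singleton.mem Empty.elim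
  · rw [h_eq hh, idOn_eq_graphOn, restrict_graphOn hAB, idOn_eq_graphOn]
  · rw [idOn_eq_graphOn, comp_graphOn (Set.mapsTo_id _), Function.id_comp]

end RigidBased

section Uniformisation

variable {Ξ : PermExt} {M : Set ZFSet.{u}} {X D E T r r' e e' R R' : ZFSet.{u}}

namespace PermExt

theorem total_inj {X' D' : ZFSet.{u}} : Ξ.total X D r e R = Ξ.total X' D' r' e' R' →
    X = X' ∧ R = R' := fun h =>
  ⟨(RelLang.str_inj.1 h).1, congrFun (RelLang.str_inj.1 h).2 2⟩

theorem IsTorsor.mono (h : Ξ.IsTorsor D r) (hDE : D ⊆ E) : Ξ.IsTorsor E r := by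
  obtain ⟨t, ht, htD, rfl⟩ := h
  exact ⟨t, ht, fun i => hDE (htD i), rfl⟩

theorem Extends.of_subset (h : Ξ.Extends X T r R) (hDT : D ⊆ T) (hr : Ξ.IsTorsor D r) :
    Ξ.Extends (D ∪ (X \ T)) D r R := by
  obtain ⟨t, ht⟩ := h
  have htD : ∀ i, (t ∘ Fin.castAdd Ξ.m) i ∈ D :=
    tup_mem_funs.1 (hr.subset_funs (ht.r_eq ▸ self_mem_orb))
  have mem_sdiff {x : ZFSet.{u}} : x ∈ X \ T ↔ ∃ j, t (Fin.natAdd Ξ.n j) = x := by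
    rw [ZFSet.mem_sdiff, ← SetLike.mem_coe, ht.coe_X_eq]
    simp only [Set.mem_union, SetLike.mem_coe, ZFSet.mem_range, Function.comp_apply]
    refine ⟨fun h => h.1.resolve_left h.2, fun h => ⟨.inr h, ?_⟩⟩
    obtain ⟨j, rfl⟩ := h
    exact ht.natAdd_notMem j
  refine ⟨t, ht.injective, htD, fun j hj => ht.natAdd_notMem j (hDT hj), ht.r_eq, ht.R_eq, ?_⟩
  ext x
  rw [ZFSet.mem_union, ZFSet.mem_union, mem_sdiff, ZFSet.mem_range]
  constructor
  · exact .imp_right fun ⟨j, hj⟩ => ⟨_, hj⟩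
  · rintro (hx | ⟨i, rfl⟩)
    · exact .inl hx
    · exact i.addCases (fun i => .inl (htD i)) fun j => .inr ⟨j, rfl⟩

variable (Ξ) in
/-- The structure coded by `B` arises from the extension that `φ` selects over the transitive
closure of the base coded by `A`: the points of the transitive closure outside the base are
removed. -/
def Selects (φ : ParamFormula M 2) (A B : ZFSet.{u}) : Prop :=
  ∃ D ∈ M, ∃ r ∈ M, ∃ X ∈ M, ∃ R ∈ M, A = (Ξ.base D r ∅).code ∧
    Holds₂ φ (Ξ.base (tc D) r (memRel (tc D))).code
      (Ξ.total X (tc D) r (memRel (tc D)) R).code ∧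
    B = (Ξ.total (D ∪ (X \ tc D)) D r ∅ R).code

theorem selects_iff {φ : ParamFormula M 2} (hD : D ∈ M) (hr : r ∈ M) (hX : X ∈ M) (hR : R ∈ M)
    (hφ : ∀ y, Holds₂ φ (Ξ.base (tc D) r (memRel (tc D))).code y ↔
      y = (Ξ.total X (tc D) r (memRel (tc D)) R).code) {B : ZFSet.{u}} :
    Ξ.Selects φ (Ξ.base D r ∅).code B ↔ B = (Ξ.total (D ∪ (X \ tc D)) D r ∅ R).code := by
  constructor
  · rintro ⟨D', -, r', -, X', -, R', -, hA, h, rfl⟩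
    obtain ⟨rfl, rfl, -⟩ := base_inj.1 (Str.code_injective hA)
    obtain ⟨rfl, rfl⟩ := total_inj (Str.code_injective ((hφ _).1 h))
    rfl
  · rintro rfl
    exact ⟨D, hD, r, hr, X, hX, R, hR, rfl, (hφ _).2 rfl, rfl⟩

variable [hM : IsTransitiveModelWeakZF M]

theorem exists_holds₂_iff_selects (φ : ParamFormula M 2) : ∃ ψ : ParamFormula M 2, ∀ A B,
    Holds₂ ψ A B ↔ A ∈ M ∧ B ∈ M ∧ Ξ.Selects φ A B :=
  Definable.exists_holds₂ (p := Ξ.Selects φ) <| .ex <| .ex <| .ex <| .ex <|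
    (DefinableFun.definable_eq (.var _) (definableFun_base (.var _) (.var _)
      (.const empty_mem))).and <|
    (DefinableFun.definable_holds₂ (definableFun_base (.tc (.var _)) (.var _)
      (.memRel (.tc (.var _)))) (definableFun_total (.var _) (.tc (.var _)) (.var _)
      (.memRel (.tc (.var _))) (.var _)) φ).and <|
    DefinableFun.definable_eq (.var _) (definableFun_total
      (.union (.var _) (.sdiff (.var _) (.tc (.var _)))) (.var _) (.var _) (.const empty_mem)
      (.var _))

theorem exists_holds₂_iff_eq_total {φ : ParamFormula M 2}
    (hφ : ∀ A, (Ξ.construction (M := M) .wellFoundedExtensional).InDomain A →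
      ∃ B : Str.{u}, Holds₂ φ A.code B.code ∧ (∀ y, Holds₂ φ A.code y → y = B.code) ∧
        (Ξ.construction (M := M) .wellFoundedExtensional).InGraph B ∧
        (Ξ.construction (M := M) .wellFoundedExtensional).Minus B A)
    (hD : D ∈ M) (hr : r ∈ M) (he : e ∈ M) (hDe : IsWellFoundedExtensional M D e)
    (hDr : Ξ.IsTorsor D r) :
    ∃ X ∈ M, ∃ R ∈ M, Ξ.Extends X D r R ∧
      ∀ y, Holds₂ φ (Ξ.base D r e).code y ↔ y = (Ξ.total X D r e R).code := by
  obtain ⟨B, hB, h_unique, h_graph, h_minus⟩ :=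
    hφ _ (inDomain_iff.2 ⟨D, hD, r, hr, e, he, rfl, hDe, hDr⟩)
  obtain ⟨X, hX, D', -, r', -, e', -, R, hR, rfl, hK, hext⟩ := inGraph_iff.1 h_graph
  obtain ⟨rfl, rfl, rfl⟩ := base_inj.1 ((hext.isMinus_iff hK.subset_funs).1 h_minus)
  exact ⟨X, hX, R, hR, hext, fun y => ⟨h_unique y, fun h => h ▸ hB⟩⟩

theorem uniformisable_construction_ofCard {n : ℕ}
    (h : (Ξ.construction (M := M) .wellFoundedExtensional).Uniformisable) :
    (Ξ.construction (M := M) (.ofCard n)).Uniformisable := by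
  obtain ⟨φ, hφ⟩ := h
  obtain ⟨ψ, hψ⟩ := exists_holds₂_iff_selects (Ξ := Ξ) φ
  refine ⟨ψ, fun A hA => ?_⟩
  obtain ⟨D, hD, r, hr, _, -, rfl, ⟨hDn, rfl⟩, hDr⟩ := inDomain_iff.1 hA
  have hT : tc D ∈ M := tc_mem hD
  have he : memRel (tc D) ∈ M := (DefinableFun.const hT).memRel.mem Empty.elim
  obtain ⟨X, hX, R, hR, hext, hφX⟩ := exists_holds₂_iff_eq_total hφ hT hr he
    (isWellFoundedExtensional_memRel (isTransitive_tc _)) (hDr.mono (subset_tc _))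
  have hext' : Ξ.Extends (D ∪ (X \ tc D)) D r R := hext.of_subset (subset_tc _) hDr
  have hX' : D ∪ (X \ tc D) ∈ M :=
    ((DefinableFun.const hD).union (.sdiff (.const hX) (.const hT))).mem Empty.elim
  have hB : (Ξ.construction (M := M) (.ofCard n)).InGraph (Ξ.total (D ∪ (X \ tc D)) D r ∅ R) :=
    inGraph_iff.2 ⟨_, hX', D, hD, r, hr, ∅, empty_mem, R, hR, rfl, ⟨hDn, rfl⟩, hext'⟩
  have h_selects (B : ZFSet.{u}) := selects_iff hD hr hX hR hφX (B := B)
  refine ⟨_, (hψ _ _).2 ⟨base_code_mem_iff.2 ⟨hD, hr, empty_mem⟩, hB.1, (h_selects _).2 rfl⟩,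
    fun y hy => (h_selects y).1 ((hψ _ _).1 hy).2.2, hB, ?_⟩
  exact (hext'.isMinus_iff (ZFSet.empty_subset _)).2 rfl

end PermExt

end Uniformisation

/-! ### Weak splittings -/

open scoped commutatorElement

section WeakSplitting

variable {G H : Type*} [Group G] [Group H] {ν : G →* H}

/-- The homomorphism `ν` has a weak splitting. The words in the letters `s h` that come from the
relators of `H` form a subgroup of `G`, so a commutative `G₀` containing them exists as soon as they
commute with each other. -/
def IsWeaklySplit (ν : G →* H) : Prop :=
  ∃ s : H → G, (∀ h, ν (s h) = h) ∧ ∀ x y : FreeGroup H, FreeGroup.lift id x = 1 →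
    FreeGroup.lift id y = 1 → Commute (FreeGroup.lift s x) (FreeGroup.lift s y)

theorem isWeaklySplit_of_leftInverse {s : H →* G} (hs : Function.LeftInverse ν s) :
    IsWeaklySplit ν := by
  have h_lift (x : FreeGroup H) : FreeGroup.lift s x = s (FreeGroup.lift id x) :=
    DFunLike.congr_fun (FreeGroup.ext_hom (FreeGroup.lift s) (s.comp (FreeGroup.lift id)) <| by
      simp) x
  refine ⟨s, hs, fun x y hx _ => ?_⟩
  rw [h_lift x, hx, map_one]
  exact .one_left _

theorem IsWeaklySplit.exists_commute_commutators (hν : IsWeaklySplit ν) {a b c : H}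
    (hab : Commute a b) (hac : Commute a c) :
    ∃ a' b' c', ν a' = a ∧ ν b' = b ∧ ν c' = c ∧ Commute ⁅a', b'⁆ ⁅a', c'⁆ := by
  obtain ⟨s, hs, h_comm⟩ := hν
  refine ⟨s a, s b, s c, hs a, hs b, hs c, ?_⟩
  have h := h_comm ⁅FreeGroup.of a, FreeGroup.of b⁆ ⁅FreeGroup.of a, FreeGroup.of c⁆
  simp only [map_commutatorElement, FreeGroup.lift_apply_of, id] at h
  exact h (commutatorElement_eq_one_iff_commute.2 hab) (commutatorElement_eq_one_iff_commute.2 hac)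

end WeakSplitting

section Permutations

variable {k : ℕ}

theorem mem_num {x : ZFSet.{u}} : x ∈ num k ↔ ∃ i : Fin k, num i = x := by
  rw [num_eq_range, ZFSet.mem_range]

/-- The action of the permutations of `Fin k` on the elements of the numeral `k`; all other sets
are fixed. -/
noncomputable def numPerm (k : ℕ) : Equiv.Perm (Fin k) →* Equiv.Perm ZFSet.{u} :=
  Equiv.Perm.viaEmbeddingHom ⟨fun i => num i, num_injective.comp Fin.val_injective⟩

theorem numPerm_num (σ : Equiv.Perm (Fin k)) (i : Fin k) : numPerm k σ (num i) = num (σ i) :=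
  σ.viaEmbedding_apply ⟨fun i => num i, num_injective.comp Fin.val_injective⟩ i

theorem mapsTo_numPerm (σ : Equiv.Perm (Fin k)) :
    Set.MapsTo (numPerm k σ) (num.{u} k) (num k) := fun x hx => by
  obtain ⟨i, rfl⟩ := mem_num.1 hx
  rw [numPerm_num]
  exact num_mem_num (σ i).2

theorem invOn_numPerm (σ : Equiv.Perm (Fin k)) :
    Set.InvOn (numPerm k σ⁻¹) (numPerm k σ) (num.{u} k) (num k) := by
  constructor <;> intro x _
  · rw [map_inv, Equiv.Perm.inv_def, Equiv.symm_apply_apply]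
  · rw [map_inv, Equiv.Perm.inv_def, Equiv.apply_symm_apply]

theorem bijOn_numPerm (σ : Equiv.Perm (Fin k)) :
    Set.BijOn (numPerm k σ) (num.{u} k) (num k) :=
  (invOn_numPerm σ).bijOn (mapsTo_numPerm σ) (mapsTo_numPerm σ⁻¹)

/-- A permutation of `Fin k` as a set of pairs of numerals. -/
noncomputable def permSet (σ : Equiv.Perm (Fin k)) : ZFSet.{u} := graphOn (numPerm k σ) (num k)

theorem permSet_eq_tup (σ : Equiv.Perm (Fin k)) : permSet.{u} σ = tup fun i => num (σ i) :=
  (tup_eq_graphOn (numPerm_num σ)).symm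

theorem permSet_injective : Function.Injective (permSet.{u} (k := k)) := fun σ τ h => by
  rw [permSet_eq_tup, permSet_eq_tup] at h
  exact Equiv.ext fun i => Fin.ext (num_injective (congrFun (tup_injective h) i))

theorem permSet_one : permSet.{u} (1 : Equiv.Perm (Fin k)) = idOn (num k) := by
  rw [permSet, map_one, idOn_eq_graphOn, Equiv.Perm.coe_one]

theorem permSet_mul (σ τ : Equiv.Perm (Fin k)) :
    permSet.{u} (σ * τ) = comp (permSet σ) (permSet τ) := by
  rw [permSet, permSet, permSet, comp_graphOn (mapsTo_numPerm τ), map_mul, Equiv.Perm.coe_mul]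

theorem permSet_inv (σ : Equiv.Perm (Fin k)) : permSet.{u} σ⁻¹ = inv (permSet σ) :=
  (inv_graphOn (mapsTo_numPerm σ) (mapsTo_numPerm σ⁻¹) (invOn_numPerm σ)).symm

theorem wordProd_permSet {α G : Type*} [Group G] (φ : G →* Equiv.Perm (Fin k)) (f : α → G)
    (L : List (α × Bool)) :
    wordProd (num.{u} k) (L.map fun p => (permSet (φ (f p.1)), p.2)) =
      permSet (φ (FreeGroup.lift f (FreeGroup.mk L))) := by
  induction L with
  | nil => exact permSet_one.symm.trans (congrArg permSet (map_one φ).symm)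
  | cons p L ih =>
    rw [FreeGroup.lift_mk] at ih ⊢
    obtain ⟨a, _ | _⟩ := p
    · simp only [List.map_cons, wordProd, ih, List.prod_cons, cond_false, map_mul, map_inv,
        permSet_mul, permSet_inv]
    · simp only [List.map_cons, wordProd, ih, List.prod_cons, cond_true, map_mul, permSet_mul]

end Permutations

section Numerals

variable {Ξ : PermExt} {M : Set ZFSet.{u}}

namespace PermExt

variable (Ξ) in
/-- The base structure on the numeral `n`. -/
noncomputable def numBase : Str.{u} := Ξ.base (num Ξ.n) (orb Ξ.ρ fun i => num i) ∅

variable (Ξ) in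
/-- The extension of `numBase` to the numeral `n + m`. -/
noncomputable def numTotal : Str.{u} :=
  Ξ.total (num (Ξ.n + Ξ.m)) (num Ξ.n) (orb Ξ.ρ fun i => num i) ∅ (orb Ξ.γ fun i => num i)

theorem extends_num : Ξ.Extends (num.{u} (Ξ.n + Ξ.m)) (num Ξ.n) (orb Ξ.ρ fun i => num i)
    (orb Ξ.γ fun i => num i) := by
  refine ⟨fun i => num i, num_injective.comp Fin.val_injective, fun i => num_mem_num i.2,
    fun j hj => ?_, rfl, rfl, ZFSet.ext fun x => ?_⟩
  · obtain ⟨i, hi⟩ := mem_num.1 hj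
    have := num_injective hi
    grind
  · rw [ZFSet.mem_union, mem_num, mem_num, ZFSet.mem_range]
    exact (or_iff_right_of_imp fun ⟨i, hi⟩ => ⟨i.castAdd _, hi⟩).symm

theorem numPerm_castAdd (g : Ξ.G) :
    Set.EqOn (numPerm (Ξ.n + Ξ.m) (Ξ.γ g)) (numPerm Ξ.n (Ξ.ρ (Ξ.ν g))) (num.{u} Ξ.n) := by
  intro x hx
  obtain ⟨i, rfl⟩ := mem_num.1 hx
  rw [numPerm_num, ← Fin.val_castAdd Ξ.m, numPerm_num, Ξ.γ_castAdd, Fin.val_castAdd]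

theorem restrict_permSet (g : Ξ.G) :
    restrict (permSet.{u} (Ξ.γ g)) (num Ξ.n) = permSet (Ξ.ρ (Ξ.ν g)) := by
  rw [permSet, restrict_graphOn extends_num.subset, permSet, graphOn_inj]
  exact numPerm_castAdd g

theorem exists_eq_permSet {f : ZFSet.{u}} (hf : f ∈ autSet M Ξ.highLang.lang Ξ.numTotal) :
    ∃ g, f = permSet (Ξ.γ g) := by
  have h_iso : IsIso Ξ.highLang.lang Ξ.numTotal Ξ.numTotal f := (ZFSet.mem_sep.1 hf).2.2
  obtain ⟨F, -, rfl⟩ := isBij_iff.1 h_iso.bij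
  have hr := extends_num (Ξ := Ξ).isTorsor.subset_funs
  have h_orb := ((isIso_total_iff extends_num.subset hr (ZFSet.empty_subset _)
    extends_num.subset hr (ZFSet.empty_subset _)).1 h_iso).2.2 (fun i => num i)
    fun i => num_mem_num i.2
  obtain ⟨g, hg⟩ := tup_mem_orb.1 (h_orb.1 self_mem_orb)
  refine ⟨g, ?_⟩
  rw [permSet_eq_tup]
  exact (tup_eq_graphOn (congrFun hg)).symm

variable [hM : IsTransitiveModelWeakZF M]

theorem inGraph_numTotal : (Ξ.construction (M := M) (.ofCard Ξ.n)).InGraph Ξ.numTotal :=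
  inGraph_iff.2 ⟨_, num_mem _, _, num_mem _, _,
    (DefinableFun.orb fun _ => .const (num_mem _)).mem Empty.elim, _, empty_mem, _,
    (DefinableFun.orb fun _ => .const (num_mem _)).mem Empty.elim, rfl, ⟨hasCard_num _, rfl⟩,
    extends_num⟩

theorem minus_numTotal :
    (Ξ.construction (M := M) (.ofCard Ξ.n)).Minus Ξ.numTotal Ξ.numBase :=
  (extends_num.isMinus_iff (ZFSet.empty_subset _)).2 rfl

theorem permSet_mem_autSet (h : Ξ.H) :
    permSet (Ξ.ρ h) ∈ autSet M Ξ.lowLang.lang Ξ.numBase := by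
  have h_num : numPerm Ξ.n (Ξ.ρ h) ∘ (fun i : Fin Ξ.n => num.{u} i) =
      (fun i : Fin Ξ.n => num i) ∘ Ξ.ρ h :=
    funext (numPerm_num (Ξ.ρ h))
  refine ZFSet.mem_sep.2 ⟨ZFSet.mem_powerset.2 (graphOn_subset_prod (mapsTo_numPerm _)), ?_,
    isIso_base_iff.2 ⟨bijOn_numPerm _, fun t ht => ?_, fun t _ => ?_⟩⟩
  · rw [permSet_eq_tup]
    exact tup_mem fun _ => num_mem _
  · rw [← tup_comp_mem_orb_iff (bijOn_numPerm _).injOn (fun i => num_mem_num i.2) ht, h_num,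
      orb_comp_perm]
  · exact iff_of_false (ZFSet.notMem_empty _) (ZFSet.notMem_empty _)

theorem exists_lift_of_section {s : ZFSet.{u} → ZFSet.{u}}
    (hs : ∀ h ∈ autSet M Ξ.lowLang.lang Ξ.numBase, s h ∈ autSet M Ξ.highLang.lang Ξ.numTotal)
    (h_res : ∀ h ∈ autSet M Ξ.lowLang.lang Ξ.numBase, restrict (s h) (num Ξ.n) = h) :
    ∃ l : Ξ.H → Ξ.G, (∀ h, Ξ.ν (l h) = h) ∧ ∀ h, s (permSet (Ξ.ρ h)) = permSet (Ξ.γ (l h)) := by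
  choose l hl using fun h : Ξ.H => exists_eq_permSet (hs _ (permSet_mem_autSet h))
  refine ⟨l, fun h => Ξ.ρ_injective (permSet_injective ?_), hl⟩
  rw [← restrict_permSet, ← hl, h_res _ (permSet_mem_autSet h)]

theorem isWeaklySplit_of_natural (h : (Ξ.construction (M := M) (.ofCard Ξ.n)).Natural) :
    IsWeaklySplit Ξ.ν := by
  obtain ⟨s, hs, h_res, h_mul⟩ := h _ _ inGraph_numTotal minus_numTotal
  obtain ⟨l, hl, hsl⟩ := exists_lift_of_section hs.1 h_res
  refine isWeaklySplit_of_leftInverse (s := .mk' l fun a b => ?_) hl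
  refine Ξ.γ_injective (permSet_injective.{u} ?_)
  rw [map_mul, permSet_mul, ← hsl, ← hsl, ← hsl, map_mul, permSet_mul]
  exact h_mul _ (permSet_mem_autSet a) _ (permSet_mem_autSet b)

theorem isWeaklySplit_of_weaklyNatural
    (h : (Ξ.construction (M := M) (.ofCard Ξ.n)).WeaklyNatural) : IsWeaklySplit Ξ.ν := by
  classical
  obtain ⟨s, hs, h_res, G₀, -, hG₀, h_word⟩ := h _ _ inGraph_numTotal minus_numTotal
  obtain ⟨l, hl, hsl⟩ := exists_lift_of_section hs.1 h_res
  have h_mem (x : FreeGroup Ξ.H) (hx : FreeGroup.lift id x = 1) :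
      permSet (Ξ.γ (FreeGroup.lift l x)) ∈ G₀ := by
    have h := h_word (x.toWord.map fun p => (permSet (Ξ.ρ p.1), p.2)) (fun p hp => ?_) ?_
    · simp only [List.map_map, Function.comp_def, hsl] at h
      rwa [← FreeGroup.mk_toWord (x := x), ← wordProd_permSet]
    · obtain ⟨q, -, rfl⟩ := List.mem_map.1 hp
      exact permSet_mem_autSet _
    · refine (wordProd_permSet Ξ.ρ id x.toWord).trans ?_
      rw [FreeGroup.mk_toWord, hx, map_one, permSet_one]
      rfl
  refine ⟨l, hl, fun x y hx hy => Ξ.γ_injective (permSet_injective.{u} ?_)⟩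
  rw [map_mul, map_mul, permSet_mul, permSet_mul]
  exact hG₀.comm _ (h_mem x hx) _ (h_mem y hy)

end PermExt

end Numerals

section Wreath

variable {N A Q : Type*} [Group N] [CommGroup A] [Group Q]

/-- The homomorphism from the wreath product of `N` and `Q` to `Q × A` that multiplies the images
under `q` of the coordinates in the base group. -/
def wreathHom (Q : Type*) [Group Q] [Fintype Q] (q : N →* A) : N ≀ᵣ Q →* Q × A where
  toFun w := (w.right, ∏ i, q (w.left i))
  map_one' := by simp
  map_mul' v w := by
    have h_shift : ∏ i, q (w.left (v.right⁻¹ * i)) = ∏ i, q (w.left i) :=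
      Equiv.prod_comp (Equiv.mulLeft v.right⁻¹) fun i => q (w.left i)
    simp only [RegularWreathProduct.mul_left, RegularWreathProduct.mul_right, Pi.mul_apply, map_mul,
      Finset.prod_mul_distrib, h_shift, Prod.mk_mul_mk]

theorem wreathHom_surjective [Fintype Q] {q : N →* A} (hq : Function.Surjective q) :
    Function.Surjective (wreathHom Q q) := by
  classical
  rintro ⟨s, a⟩
  obtain ⟨x, rfl⟩ := hq a
  refine ⟨⟨Pi.mulSingle 1 x, s⟩, Prod.ext rfl ?_⟩
  change ∏ i, q ((Pi.mulSingle 1 x : Q → N) i) = q x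
  rw [Fintype.prod_eq_single 1 fun i hi => by rw [Pi.mulSingle_eq_of_ne hi, map_one],
    Pi.mulSingle_eq_same]

theorem map_commutator_left_one {q : N →* A} (hA : ∀ a : A, a * a = 1) {v w : N ≀ᵣ ℤˣ} {a : A}
    (hv : v.right = -1) (hw : wreathHom ℤˣ q w = (1, a)) :
    ⁅v, w⁆.right = 1 ∧ q (⁅v, w⁆.left 1) = a := by
  obtain ⟨hw_right, hw_left⟩ := Prod.ext_iff.1 hw
  change w.right = 1 at hw_right
  change ∏ i, q (w.left i) = a at hw_left
  rw [UnitsInt.univ, Finset.prod_pair (by decide)] at hw_left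
  constructor
  · simp [commutatorElement_def, hv, hw_right]
  · have h_left : ⁅v, w⁆.left 1 = v.left 1 * w.left (-1) * (v.left 1)⁻¹ * (w.left 1)⁻¹ := by
      simp [commutatorElement_def, hv, hw_right]
    calc q (⁅v, w⁆.left 1) = q (w.left (-1)) * (q (w.left 1))⁻¹ := by
          rw [h_left, map_mul, map_mul, map_mul, map_inv, map_inv, mul_inv_cancel_comm]
      _ = a := by rw [inv_eq_of_mul_eq_one_right (hA _), mul_comm, hw_left]

theorem commute_left_one {v w : N ≀ᵣ Q} (hv : v.right = 1) (hw : w.right = 1) (h : Commute v w) :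
    Commute (v.left 1) (w.left 1) := by
  simpa [hv, hw, commute_iff_eq] using congrFun (congrArg RegularWreathProduct.left h.eq) 1

theorem commute_of_map_eq {q : N →* A} (hq : q.ker ≤ Subgroup.center N) {x x' y : N}
    (hx : q x = q x') (h : Commute x y) : Commute x' y := by
  have h_center : x⁻¹ * x' ∈ Subgroup.center N := hq (q.eq_iff.1 hx.symm)
  have h_comm : Commute (x⁻¹ * x') y := (Subgroup.mem_center_iff.1 h_center y).symm
  simpa only [mul_inv_cancel_left] using h.mul_left h_comm

theorem not_isWeaklySplit_wreathHom {q : N →* A} (hA : ∀ a : A, a * a = 1)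
    (hq : q.ker ≤ Subgroup.center N) {x y : N} (hxy : ¬ Commute x y) :
    ¬ IsWeaklySplit (wreathHom ℤˣ q) := fun h => by
  obtain ⟨a, b, c, ha, hb, hc, h_comm⟩ := h.exists_commute_commutators
    (Commute.all (-1, 1) (1, q x)) (Commute.all (-1, 1) (1, q y))
  have ha_right : a.right = -1 := congrArg Prod.fst ha
  obtain ⟨hb_right, hb_left⟩ := map_commutator_left_one hA ha_right hb
  obtain ⟨hc_right, hc_left⟩ := map_commutator_left_one hA ha_right hc
  have h_left := commute_left_one hb_right hc_right h_comm
  exact hxy (commute_of_map_eq hq hc_left (commute_of_map_eq hq hb_left h_left).symm).symm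

end Wreath

section Quaternion

theorem ker_abelianization_le_center :
    (Abelianization.of (G := QuaternionGroup 2)).ker ≤ Subgroup.center (QuaternionGroup 2) := by
  rw [Abelianization.ker_of, commutator_def, Subgroup.commutator_le]
  have h : ∀ x y z : QuaternionGroup 2, z * ⁅x, y⁆ = ⁅x, y⁆ * z := by decide
  exact fun x _ y _ => Subgroup.mem_center_iff.2 (h x y)

theorem abelianization_mul_self (a : Abelianization (QuaternionGroup 2)) : a * a = 1 := by
  obtain ⟨x, rfl⟩ := QuotientGroup.mk_surjective a
  have h : ∀ x : QuaternionGroup 2, ∃ y z : QuaternionGroup 2, x * x = ⁅y, z⁆ := by decide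
  obtain ⟨y, z, hx⟩ := h x
  change Abelianization.of x * Abelianization.of x = 1
  rw [← map_mul, hx, map_commutatorElement, commutatorElement_eq_one_iff_commute]
  exact Commute.all _ _

end Quaternion

namespace PermExt

/-- The regular actions attached to a surjection of finite groups. -/
noncomputable def ofSurjective {G H : Type} [Group G] [Group H] [Finite G] [Finite H] (ν : G →* H)
    (hν : Function.Surjective ν) : PermExt where
  n := Nat.card H
  m := Nat.card G
  n_pos := Nat.card_pos
  G := G
  H := H
  ν := ν
  ν_surjective := hν
  ρ := (Finite.equivFin H).permCongrHom.toMonoidHom.comp (MulAction.toPermHom H H)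
  γ := finSumFinEquiv.permCongrHom.toMonoidHom.comp <| (Equiv.Perm.sumCongrHom _ _).comp <|
    (((Finite.equivFin H).permCongrHom.toMonoidHom.comp (MulAction.toPermHom H H)).comp ν).prod
      ((Finite.equivFin G).permCongrHom.toMonoidHom.comp (MulAction.toPermHom G G))
  ρ_injective := (Finite.equivFin H).permCongrHom.injective.comp MulAction.toPerm_injective
  γ_injective := finSumFinEquiv.permCongrHom.injective.comp <|
    Equiv.Perm.sumCongrHom_injective.comp fun _ _ h => MulAction.toPerm_injective
      ((Finite.equivFin G).permCongrHom.injective (Prod.ext_iff.1 h).2)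
  γ_castAdd g i := by simp [Equiv.permCongrHom, Equiv.permCongr_apply]

theorem exists_not_isWeaklySplit : ∃ Ξ : PermExt, ¬ IsWeaklySplit Ξ.ν := by
  have hxy : ¬ Commute (QuaternionGroup.a 1 : QuaternionGroup 2) (.xa 0) := by
    rw [commute_iff_eq]
    decide
  exact ⟨ofSurjective _ (wreathHom_surjective (Q := ℤˣ) QuotientGroup.mk_surjective),
    not_isWeaklySplit_wreathHom abelianization_mul_self ker_abelianization_le_center hxy⟩

end PermExt

end NatDef

theorem theorem2_general (M : Set ZFSet.{u}) [NatDef.IsTransitiveModelWeakZF M] :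
    ¬ ((∀ C : NatDef.Construction M, C.RigidBased → C.Uniformisable) ∧
        (∀ C : NatDef.Construction M, C.Unitype → C.Uniformisable → C.WeaklyNatural)) ∧
    ¬ (∀ C : NatDef.Construction M, C.Natural ↔ C.Uniformisable) := by
  obtain ⟨Ξ, hΞ⟩ := NatDef.PermExt.exists_not_isWeaklySplit
  have rigidBased := Ξ.rigidBased_construction_wellFoundedExtensional (M := M)
  refine ⟨fun ⟨ha, hb⟩ => hΞ ?_, fun h => hΞ ?_⟩
  · have uniformisable :=
      NatDef.PermExt.uniformisable_construction_ofCard (n := Ξ.n) (ha _ rigidBased)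
    exact NatDef.PermExt.isWeaklySplit_of_weaklyNatural
      (hb _ Ξ.unitype_construction_ofCard uniformisable)
  · have uniformisable :=
      NatDef.PermExt.uniformisable_construction_ofCard (n := Ξ.n) ((h _).1 rigidBased.natural)
    exact NatDef.PermExt.isWeaklySplit_of_natural ((h _).2 uniformisable)

theorem theorem2 (M : Set ZFSet.{u}) (hM : NatDef.IsTransitiveModelZFC M) :
    ¬ ((∀ C : NatDef.Construction M, C.RigidBased → C.Uniformisable) ∧
        (∀ C : NatDef.Construction M, C.Unitype → C.Uniformisable → C.WeaklyNatural)) ∧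
    ¬ (∀ C : NatDef.Construction M, C.Natural ↔ C.Uniformisable) :=
  have := hM.toWeakZF
  theorem2_general M
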